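/- Let $1<p<\infty$ and $0<\alpha<\infty$. Let $\mathbb D$ be the open unit disc of $\mathbb C$ and $dA=\frac1\pi\,dx\,dy$. For $\mu>0$ let $A^p_\mu$ be the space of analytic functions $f$ on $\mathbb D$ with $\|f\|_{p,\mu}=\bigl(\int_{\mathbb D}|f(z)|^p(1-|z|)^\mu\,dA(z)\bigr)^{1/p}<\infty$, and let $A^p_{\alpha+}=\bigcap_{\mu>\alpha}A^p_\mu$, with the Fréchet topology given by the norms $\|\cdot\|_{p,\alpha+1/n}$, $n=1,2,\dots$ The Cesàro operator is $$\mathsf C f(z)=\frac1z\int_0^z\frac{f(\zeta)}{1-\zeta}\,d\zeta\quad(0<|z|<1),\qquad \mathsf C f(0)=f(0).$$ For a continuous linear operator $T$ on a locally convex Hausdorff space $X$ over $\mathbb C$, the resolvent set $\rho(T)$ consists of all $\lambda\in\mathbb C$ for which $R(\lambda,T)=(\lambda I-T)^{-1}$ exists as a continuous linear operator on $X$; the spectrum is $\sigma(T)=\mathbb C\setminus\rho(T)$; the point spectrum $\sigma_{pt}(T)$ consists of all $\lambda$ for which $\lambda I-T$ is not injective. Let $\rho^*(T)$ be the set of all $\lambda\in\mathbb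 C$ for which there is $\delta>0$ such that $B(\lambda,\delta)=\{\nu\in\mathbb C:|\nu-\lambda|<\delta\}\subseteq\rho(T)$ and $\{R(\nu,T):\nu\in B(\lambda,\delta)\}$ is equicontinuous; the Waelbroeck spectrum is $\sigma^*(T)=\mathbb C\setminus\rho^*(T)$. For $r>0$ let $D_r=\{\lambda\in\mathbb C:|\lambda-\frac1{2r}|<\frac1{2r}\}$. Then $\mathsf C$ is a continuous linear operator from $A^p_{\alpha+}$ into itself, and the following hold for it, with $\mathbb N=\{1,2,\dots\}$: 1. $\left\{\frac1m: m\in\mathbb N,\ m<\frac{2+\alpha}p\right\}\subseteq\sigma_{pt}(\mathsf C)\subseteq\left\{\frac1m: m\in\mathbb N,\ m\le\frac{2+\alpha}p\right\}$; 2. $\sigma(\mathsf C)=\{0\}\cup D_{(2+\alpha)/p}\cup\sigma_{pt}(\mathsf C)$; 3. $\sigma^*(\mathsf C)=\overline{\sigma(\mathsf C)}$. -/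

import Mathlib

open MeasureTheory Metric Set
open scoped ENNReal Topology

noncomputable section

namespace CesaroBergman

/-- The measure `dA_μ = (1 - |z|)^μ dA(z)` on the open unit disc of `ℂ`, where
`dA = (1 / π) dx dy`; it gives no mass to the complement of the disc. -/
def diskMeasure (μ : ℝ) : Measure ℂ :=
  (volume.restrict (ball (0 : ℂ) 1)).withDensity
    (fun z => ENNReal.ofReal ((1 - ‖z‖) ^ μ / Real.pi))

/-- The space `H(𝔻)` of analytic functions on the open unit disc. A function on the disc is
encoded by its extension by zero to `ℂ`, so that equality of two elements is equality of the
functions on the disc. -/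
def holo : Submodule ℂ (ℂ → ℂ) where
  carrier := {f | DifferentiableOn ℂ f (ball 0 1) ∧ ∀ z, z ∉ ball (0 : ℂ) 1 → f z = 0}
  zero_mem' := ⟨differentiableOn_const 0, fun _ _ => rfl⟩
  add_mem' := fun {f g} hf hg =>
    ⟨hf.1.add hg.1, fun z hz => by simp [hf.2 z hz, hg.2 z hz]⟩
  smul_mem' := fun c f hf =>
    ⟨hf.1.const_smul c, fun z hz => by simp [hf.2 z hz]⟩

/-- The weighted Bergman space `A^p_μ`: analytic functions `f` on the disc with
`∫ |f|^p dA_μ < ∞`. -/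
def bergman (p μ : ℝ) : Submodule ℂ (ℂ → ℂ) where
  carrier := {f | f ∈ holo ∧ MemLp f (ENNReal.ofReal p) (diskMeasure μ)}
  zero_mem' := ⟨holo.zero_mem, MemLp.zero⟩
  add_mem' := fun hf hg => ⟨holo.add_mem hf.1 hg.1, hf.2.add hg.2⟩
  smul_mem' := fun c _ hf => ⟨holo.smul_mem c hf.1, hf.2.const_smul c⟩

/-- `A^p_{α+}`, the intersection of the `A^p_μ` over all `μ > α`, as a vector space. -/
def bergmanPlus (p α : ℝ) : Submodule ℂ (ℂ → ℂ) :=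
  ⨅ μ : {μ : ℝ // α < μ}, bergman p μ

/-- The space `A^p_{α+}` as a type of its own. (The coercion of the submodule to a type would
carry the topology of pointwise convergence; here the Fréchet topology is put on it.) -/
def BergmanPlus (p α : ℝ) : Type := ↥(bergmanPlus p α)

namespace BergmanPlus

variable {p α : ℝ}

instance : AddCommGroup (BergmanPlus p α) := inferInstanceAs (AddCommGroup ↥(bergmanPlus p α))

instance : Module ℂ (BergmanPlus p α) := inferInstanceAs (Module ℂ ↥(bergmanPlus p α))

instance : CoeFun (BergmanPlus p α) (fun _ => ℂ → ℂ) := ⟨fun f => f.1⟩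

theorem mem_bergman (f : BergmanPlus p α) {μ : ℝ} (h : α < μ) : (f : ℂ → ℂ) ∈ bergman p μ :=
  (Submodule.mem_iInf _).1 f.2 ⟨μ, h⟩

/-- The norm `‖f‖_{p,μ} = (∫ |f|^p dA_μ)^{1/p}` of `A^p_μ`, for `μ > α`, restricted to
`A^p_{α+}`. -/
def normAt [hp : Fact (1 < p)] (μ : ℝ) (h : α < μ) : Seminorm ℂ (BergmanPlus p α) :=
  Seminorm.of (fun f => (eLpNorm (f : ℂ → ℂ) (ENNReal.ofReal p) (diskMeasure μ)).toReal)
    (fun f g => by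
      have hf := (mem_bergman f h).2
      have hg := (mem_bergman g h).2
      have h1 : (1 : ℝ≥0∞) ≤ ENNReal.ofReal p := by
        simpa using ENNReal.ofReal_le_ofReal hp.out.le
      rw [← ENNReal.toReal_add hf.2.ne hg.2.ne]
      exact ENNReal.toReal_mono (ENNReal.add_ne_top.2 ⟨hf.2.ne, hg.2.ne⟩)
        (eLpNorm_add_le hf.1 hg.1 h1))
    (fun c f => by
      have := eLpNorm_const_smul c (f : ℂ → ℂ) (ENNReal.ofReal p) (diskMeasure μ)
      change (eLpNorm (c • (f : ℂ → ℂ)) _ _).toReal = _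
      rw [this, ENNReal.toReal_mul]
      simp)

/-- The norms of `A^p_{α + 1/n}`, `n = 1, 2, …` (indexed from `0` by `n - 1`). -/
def norms (p α : ℝ) [Fact (1 < p)] : SeminormFamily ℂ (BergmanPlus p α) ℕ :=
  fun n => normAt (α + 1 / ((n : ℝ) + 1)) (lt_add_of_pos_right α (by positivity))

variable [Fact (1 < p)]

/-- The Fréchet topology of `A^p_{α+}`: the locally convex topology generated by `norms`. -/
instance : TopologicalSpace (BergmanPlus p α) := (norms p α).moduleFilterBasis.topology

theorem withSeminorms_norms : WithSeminorms (norms p α) := ⟨rfl⟩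

instance : IsTopologicalAddGroup (BergmanPlus p α) := withSeminorms_norms.topologicalAddGroup

instance : ContinuousSMul ℂ (BergmanPlus p α) := withSeminorms_norms.continuousSMul

end BergmanPlus

section Spectra

variable {X : Type*} [AddCommGroup X] [Module ℂ X] [TopologicalSpace X]
  [IsTopologicalAddGroup X] [ContinuousSMul ℂ X]

/-- The point spectrum: all `lam` for which `lam I - T` is not injective. -/
def pointSpectrum (T : X →L[ℂ] X) : Set ℂ :=
  {lam | ¬ Function.Injective (fun x : X => lam • x - T x)}

/-- `ρ*(T)`: all `lam` with a disc `B(lam, δ)` inside the resolvent set on which the resolvents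
`R(ν, T) = (ν I - T)⁻¹` form an equicontinuous family (with respect to the canonical uniform
structure of the topological vector space `X`). -/
def waelbroeckResolventSet (T : X →L[ℂ] X) : Set ℂ :=
  letI : UniformSpace X := IsTopologicalAddGroup.rightUniformSpace X
  {lam | ∃ δ : ℝ, 0 < δ ∧ ball lam δ ⊆ resolventSet ℂ T ∧
    Equicontinuous (fun (ν : ball lam δ) (x : X) => resolvent T (ν : ℂ) x)}

/-- The Waelbroeck spectrum `σ*(T)`, the complement of `ρ*(T)`. -/
def waelbroeckSpectrum (T : X →L[ℂ] X) : Set ℂ := (waelbroeckResolventSet T)ᶜ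

end Spectra

/-- The Cesàro operator: `C f (z) = (1 / z) ∫_0^z f(ζ) / (1 - ζ) dζ` for `z ≠ 0` (the integral
being taken along the segment `ζ = t z`, `0 ≤ t ≤ 1`) and `C f (0) = f 0`. -/
def cesaro (f : ℂ → ℂ) (z : ℂ) : ℂ :=
  if z = 0 then f 0
  else (1 / z) * ∫ t in (0 : ℝ)..1, f ((t : ℂ) * z) / (1 - (t : ℂ) * z) * z

/-- The open disc `D_r` with centre and radius `1 / (2 r)`. -/
def D (r : ℝ) : Set ℂ := {lam | ‖lam - ((1 / (2 * r) : ℝ) : ℂ)‖ < 1 / (2 * r)}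

end CesaroBergman

end

/-! With γ = 1/λ and v = C f, the equation λ f - C f = g becomes the first-order linear equation v +
z v' = (γ v + γ g)/(1 - z) on the disc (`resolvent_ode`). Its homogeneous solution is z^(γ-1)
(1-z)^(-γ). This is single-valued and analytic at 0 only for γ = 1, 2, ..., and near 1 it has size
|1-z|^(-Re γ) up to constants, a power that lies in A^p_μ exactly when p Re γ < 2 + μ. Asking this
for every μ > α gives p Re γ ≤ 2 + α. With r = (2+α)/p, the disc D_r is the half-plane Re γ > r
(`mem_D_iff`), so the position of Re γ relative to r decides everything.

Solvability for Re γ ≤ r: along the flow φ_q(z) = qz/(1-(1-q)z) the equation integrates to v(z) =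
∫_0^1 q^(-γ) γ g(φ_q z)/(1-(1-q)z) dq as soon as v vanishes to high order at 0
(`hasDerivAt_flowComp`, `enorm_le_flow_average`). On functions divisible by a high power z^m these
weighted composition operators have A^p_μ-norm O(q^((2+μ)/p - 1)) (`lintegral_flowComp_le`), so the
average is bounded for Re γ < (2+μ)/p, hence for all μ > α at once (`bnorm_le_of_flow_average`). The
low Taylor coefficients of g are removed one at a time by multiples of λ z^k - C z^k, whose leading
coefficient is λ - 1/(k+1) (`exists_resolvent_bound`). The bounds depend only on an upper bound for
|λ| and on the distance of λ from 0 and the points 1/(k+1); this uniformity is what yields the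
Waelbroeck spectrum.

Obstruction for Re γ > r: the pointwise growth bound in A^p_μ forces t^(1-γ) (1-t)^γ v(t) → 0 as t →
1. For g = z^N with N large this says that a Beta integral is zero, which is impossible
(`not_surjective_of_mem_D`). With g = 0 the same product is constant on (0,1), which locates the
eigenvalues (`eigenvalue_of_ne_zero`). The value λ = 0 needs its own function outside the range
(`not_mem_range_cesaro`). -/

namespace CesaroBergman

/-! ### Weighted norms with values in [0, ∞]. -/

/-- The norm of `A^p_μ` with values in `[0, ∞]`. -/
noncomputable abbrev bnorm (p μ : ℝ) (f : ℂ → ℂ) : ℝ≥0∞ := eLpNorm f (ENNReal.ofReal p) (diskMeasure μ)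

lemma measurable_weight (μ : ℝ) :
    Measurable fun z : ℂ => ENNReal.ofReal ((1 - ‖z‖) ^ μ / Real.pi) := by
  fun_prop

lemma lintegral_diskMeasure (μ : ℝ) (F : ℂ → ℝ≥0∞) :
    ∫⁻ z, F z ∂diskMeasure μ =
      ∫⁻ z in ball (0 : ℂ) 1, ENNReal.ofReal ((1 - ‖z‖) ^ μ / Real.pi) * F z := by
  unfold diskMeasure
  rw [lintegral_withDensity_eq_lintegral_mul_non_measurable _ (measurable_weight μ)]
  · rfl
  · exact Filter.Eventually.of_forall fun _ => ENNReal.ofReal_lt_top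

lemma ae_diskMeasure {μ : ℝ} {P : ℂ → Prop} (h : ∀ z ∈ ball (0 : ℂ) 1, P z) :
    ∀ᵐ z ∂diskMeasure μ, P z :=
  (withDensity_absolutelyContinuous _ _).ae_le (ae_restrict_of_forall_mem measurableSet_ball h)

lemma diskMeasure_anti {μ ν : ℝ} (h : μ ≤ ν) : diskMeasure ν ≤ diskMeasure μ := by
  refine withDensity_mono ((ae_restrict_of_forall_mem measurableSet_ball) fun z hz => ?_)
  rw [mem_ball_zero_iff] at hz
  refine ENNReal.ofReal_le_ofReal (div_le_div_of_nonneg_right ?_ Real.pi_pos.le)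
  exact Real.rpow_le_rpow_of_exponent_ge (by linarith) (by linarith [norm_nonneg z]) h

lemma isFiniteMeasure_diskMeasure {μ : ℝ} (h : 0 ≤ μ) : IsFiniteMeasure (diskMeasure μ) := by
  have : IsFiniteMeasure (volume.restrict (ball (0 : ℂ) 1)) := ⟨by simp⟩
  refine isFiniteMeasure_withDensity_ofReal (HasFiniteIntegral.of_bounded (C := 1 / Real.pi) ?_)
  · refine (ae_restrict_of_forall_mem measurableSet_ball) fun z hz => ?_
    rw [mem_ball_zero_iff] at hz
    have h1 : 0 ≤ (1 - ‖z‖) ^ μ := Real.rpow_nonneg (by linarith) _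
    rw [Real.norm_of_nonneg (by positivity)]
    gcongr
    exact Real.rpow_le_one (by linarith) (by linarith [norm_nonneg z]) h

lemma measurable_of_mem_holo {f : ℂ → ℂ} (hf : f ∈ holo) : Measurable f := by
  classical
  have : f = (ball (0 : ℂ) 1).piecewise f 0 := by
    ext z
    by_cases hz : z ∈ ball (0 : ℂ) 1
    · simp [piecewise_eq_of_mem _ _ _ hz]
    · simp [piecewise_eq_of_notMem _ _ _ hz, hf.2 z hz]
  rw [this]
  exact hf.1.continuousOn.measurable_piecewise continuousOn_const measurableSet_ball

lemma bnorm_rpow {p : ℝ} (hp : 0 < p) (μ : ℝ) (f : ℂ → ℂ) :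
    bnorm p μ f ^ p =
      ∫⁻ z in ball (0 : ℂ) 1, ENNReal.ofReal ((1 - ‖z‖) ^ μ / Real.pi) * ‖f z‖ₑ ^ p := by
  rw [bnorm, eLpNorm_eq_lintegral_rpow_enorm_toReal (by simpa using hp) ENNReal.ofReal_ne_top,
    ENNReal.toReal_ofReal hp.le, ← ENNReal.rpow_mul, one_div_mul_cancel hp.ne', ENNReal.rpow_one,
    lintegral_diskMeasure]

lemma bnorm_mono {p μ : ℝ} {f g : ℂ → ℂ} (h : ∀ z ∈ ball (0 : ℂ) 1, ‖f z‖ ≤ ‖g z‖) :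
    bnorm p μ f ≤ bnorm p μ g :=
  eLpNorm_mono_ae (ae_diskMeasure h)

lemma bnorm_congr {p μ : ℝ} {f g : ℂ → ℂ} (h : ∀ z ∈ ball (0 : ℂ) 1, f z = g z) :
    bnorm p μ f = bnorm p μ g :=
  eLpNorm_congr_ae (ae_diskMeasure h)

lemma bnorm_anti {p μ ν : ℝ} (h : μ ≤ ν) (f : ℂ → ℂ) : bnorm p ν f ≤ bnorm p μ f :=
  eLpNorm_mono_measure _ (diskMeasure_anti h)

lemma bnorm_le_of_bounded {p μ : ℝ} (hμ : 0 ≤ μ) :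
    ∃ M : ℝ≥0∞, M ≠ ∞ ∧ ∀ (f : ℂ → ℂ) (c : ℝ), (∀ z ∈ ball (0 : ℂ) 1, ‖f z‖ ≤ c) →
      bnorm p μ f ≤ M * ENNReal.ofReal c := by
  have := isFiniteMeasure_diskMeasure hμ
  refine ⟨diskMeasure μ univ ^ ((ENNReal.ofReal p).toReal⁻¹), ?_, fun f c h => ?_⟩
  · exact ENNReal.rpow_ne_top_of_nonneg (by positivity) (measure_ne_top _ _)
  · exact eLpNorm_le_of_ae_bound (ae_diskMeasure h)

lemma mem_bergmanPlus {p α : ℝ} {f : ℂ → ℂ} (hf : f ∈ holo)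
    (h : ∀ n : ℕ, bnorm p (α + 1 / ((n : ℝ) + 1)) f < ∞) : f ∈ bergmanPlus p α := by
  refine (Submodule.mem_iInf _).2 fun ⟨μ, hμ⟩ => ⟨hf, ?_, ?_⟩
  · exact (measurable_of_mem_holo hf).aestronglyMeasurable
  · obtain ⟨n, hn⟩ := exists_nat_one_div_lt (sub_pos.2 hμ)
    exact (bnorm_anti (by linarith) f).trans_lt (h n)

/-! ### Pointwise growth of Bergman functions. -/

/-- The sub-mean value inequality over discs, with a rough constant. -/
lemma enorm_le_lintegral_ball {f : ℂ → ℂ} (hf : f ∈ holo) {z : ℂ} {R : ℝ} (hR : 0 < R)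
    (hz : closedBall z R ⊆ ball 0 1) :
    ENNReal.ofReal (R ^ 2) * ‖f z‖ₑ ≤ ∫⁻ w in ball z R, ‖f w‖ₑ := by
  have hm := measurable_of_mem_holo hf
  have key : ∀ r ∈ Ioo 0 R, ENNReal.ofReal (2 * Real.pi) * ‖f z‖ₑ ≤
      ∫⁻ θ in Ioo (-Real.pi) Real.pi, ‖f (circleMap z r θ)‖ₑ := by
    intro r hr
    have hd : DiffContOnCl ℂ f (ball z |r|) := by
      refine (hf.1.mono ?_).diffContOnCl
      refine (closure_ball_subset_closedBall).trans ((closedBall_subset_closedBall ?_).trans hz)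
      rw [abs_of_pos hr.1]; exact hr.2.le
    have h1 := hd.circleAverage
    rw [Real.circleAverage_def] at h1
    have hper : Function.Periodic (fun θ => f (circleMap z r θ)) (2 * Real.pi) := fun θ => by
      simp [periodic_circleMap z r θ]
    have h2 := hper.intervalIntegral_add_eq 0 (-Real.pi)
    rw [zero_add, show -Real.pi + 2 * Real.pi = Real.pi by ring] at h2
    rw [h2] at h1
    have h3 : ((2 * Real.pi : ℝ) : ℂ) * f z = ∫ θ in (-Real.pi)..Real.pi, f (circleMap z r θ) := by
      rw [← h1, Complex.real_smul]
      push_cast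
      rw [← mul_assoc, mul_inv_cancel₀ (by simp [Real.pi_ne_zero]), one_mul]
    have h4 : ENNReal.ofReal (2 * Real.pi) * ‖f z‖ₑ = ‖((2 * Real.pi : ℝ) : ℂ) * f z‖ₑ := by
      rw [enorm_mul]
      congr 1
      rw [← ofReal_norm, Complex.norm_of_nonneg (by positivity)]
    rw [h4, h3, intervalIntegral.integral_of_le (by linarith [Real.pi_pos]),
      integral_Ioc_eq_integral_Ioo]
    exact enorm_integral_le_lintegral_enorm _
  have h1 : ∫⁻ w in ball z R, ‖f w‖ₑ =
      ∫⁻ w, (ball (0 : ℂ) R).indicator (fun w => ‖f (z + w)‖ₑ) w := by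
    rw [← lintegral_indicator measurableSet_ball,
      ← lintegral_add_left_eq_self _ z]
    congr 1
    ext w
    simp [indicator]
  have hmeas : Measurable fun p : ℝ × ℝ => (Ioo 0 R ×ˢ (univ : Set ℝ)).indicator
      (fun p : ℝ × ℝ => ENNReal.ofReal p.1 * ‖f (circleMap z p.1 p.2)‖ₑ) p := by
    refine Measurable.indicator ?_ (measurableSet_Ioo.prod MeasurableSet.univ)
    have : Measurable fun p : ℝ × ℝ => circleMap z p.1 p.2 := by
      unfold circleMap; fun_prop
    exact (ENNReal.measurable_ofReal.comp measurable_fst).mul (hm.comp this).enorm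
  rw [h1, ← Complex.lintegral_comp_polarCoord_symm]
  -- Keeping only the radii in (R/2, R), where the Jacobian r is at least R/2, gives (R/2)(R/2)(2π)
  -- = πR²/2 ≥ R².
  calc ENNReal.ofReal (R ^ 2) * ‖f z‖ₑ
      ≤ ∫⁻ r in Ioo (R / 2) R, ENNReal.ofReal (R / 2) * (ENNReal.ofReal (2 * Real.pi) * ‖f z‖ₑ) := by
        rw [setLIntegral_const, Real.volume_Ioo, ← mul_assoc, mul_right_comm,
          ← ENNReal.ofReal_mul (by positivity), ← ENNReal.ofReal_mul (by positivity)]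
        gcongr
        nlinarith [Real.pi_gt_three, sq_nonneg R]
    _ ≤ ∫⁻ r in Ioo (R / 2) R, ENNReal.ofReal r *
          ∫⁻ θ in Ioo (-Real.pi) Real.pi, ‖f (circleMap z r θ)‖ₑ := by
        refine setLIntegral_mono' measurableSet_Ioo fun r hr => ?_
        gcongr
        · exact hr.1.le
        · exact key r ⟨by linarith [hr.1], hr.2⟩
    _ ≤ ∫⁻ r in Ioi 0, ∫⁻ θ in Ioo (-Real.pi) Real.pi, (Ioo 0 R ×ˢ (univ : Set ℝ)).indicator
          (fun p : ℝ × ℝ => ENNReal.ofReal p.1 * ‖f (circleMap z p.1 p.2)‖ₑ) (r, θ) := by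
        refine (setLIntegral_mono' measurableSet_Ioo fun r hr => ?_).trans
          (lintegral_mono_set fun r hr => (by linarith [hr.1] : (0 : ℝ) < r))
        rw [← lintegral_const_mul']
        · refine lintegral_mono fun θ => ?_
          rw [indicator_of_mem]
          exact ⟨⟨by linarith [hr.1], hr.2⟩, trivial⟩
        · exact ENNReal.ofReal_ne_top
    _ = ∫⁻ p in Complex.polarCoord.target, (Ioo 0 R ×ˢ (univ : Set ℝ)).indicator
          (fun p : ℝ × ℝ => ENNReal.ofReal p.1 * ‖f (circleMap z p.1 p.2)‖ₑ) p := by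
        rw [Complex.polarCoord_target, Measure.volume_eq_prod, ← Measure.prod_restrict,
          lintegral_prod _ hmeas.aemeasurable]
    _ ≤ _ := by
        refine lintegral_mono fun q => ?_
        by_cases hq : q ∈ Ioo 0 R ×ˢ (univ : Set ℝ)
        · rw [indicator_of_mem hq, smul_eq_mul, indicator_of_mem]
          · gcongr
            apply le_of_eq
            congr 3
            rw [Complex.polarCoord_symm_apply, circleMap, Complex.exp_mul_I]
            push_cast
            ring
          · rw [mem_ball_zero_iff, Complex.norm_polarCoord_symm, abs_of_pos hq.1.1]
            exact hq.1.2
        · rw [indicator_of_notMem hq]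
          exact zero_le

/-- Pointwise growth of functions in a weighted Bergman space. -/
lemma enorm_le_bnorm {p μ : ℝ} (hp : 1 < p) (hμ : 0 ≤ μ) {f : ℂ → ℂ} (hf : f ∈ holo) {z : ℂ}
    (hz : z ∈ ball (0 : ℂ) 1) :
    ‖f z‖ₑ ≤ ENNReal.ofReal (Real.pi * ((1 - ‖z‖) / 2) ^ (-((2 + μ) / p))) * bnorm p μ f := by
  have hz' := mem_ball_zero_iff.1 hz
  set R := (1 - ‖z‖) / 2 with hRdef
  have hR : 0 < R := by rw [hRdef]; linarith
  have hp0 : 0 < p := by linarith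
  have hsub : closedBall z R ⊆ ball 0 1 := by
    intro w hw
    rw [mem_closedBall, dist_eq_norm] at hw
    rw [mem_ball_zero_iff]
    have := norm_sub_norm_le w z
    linarith
  have hm := measurable_of_mem_holo hf
  -- R is half the distance to the circle, so 1 - |w| ≥ R on the ball and the weight there is at
  -- least R^μ/π.
  have hle : ∫⁻ w in ball z R, ‖f w‖ₑ ^ p ≤
      ENNReal.ofReal (Real.pi * R ^ (-μ)) * bnorm p μ f ^ p := by
    rw [bnorm_rpow hp0, ← lintegral_const_mul' _ _ ENNReal.ofReal_ne_top]
    refine le_trans ?_ (lintegral_mono_set (ball_subset_closedBall.trans hsub))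
    refine setLIntegral_mono' measurableSet_ball fun w hw => ?_
    have h1 : R ≤ 1 - ‖w‖ := by
      rw [mem_ball, dist_eq_norm] at hw
      have := norm_sub_norm_le w z
      linarith
    rw [← mul_assoc, ← ENNReal.ofReal_mul (by positivity)]
    refine le_mul_of_one_le_left' ?_
    rw [ENNReal.one_le_ofReal, Real.rpow_neg hR.le]
    have h2 : R ^ μ ≤ (1 - ‖w‖) ^ μ := Real.rpow_le_rpow hR.le h1 hμ
    have h3 : 0 < R ^ μ := Real.rpow_pos_of_pos hR _
    have : Real.pi * (R ^ μ)⁻¹ * ((1 - ‖w‖) ^ μ / Real.pi) = (1 - ‖w‖) ^ μ / R ^ μ := by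
      field_simp
    rw [this, one_le_div h3]
    exact h2
  -- Hölder against the constant 1 turns the mean value inequality for |f| into one for |f|^p, at
  -- the cost of the area of the ball to the power 1 - 1/p.
  have hq := Real.HolderConjugate.conjExponent hp
  have hH := ENNReal.lintegral_mul_le_Lp_mul_Lq (volume.restrict (ball z R)) hq
    (f := fun w => ‖f w‖ₑ) (g := 1) hm.enorm.aemeasurable aemeasurable_const
  simp only [Pi.mul_apply, Pi.one_apply, mul_one, ENNReal.one_rpow, lintegral_const, one_mul,
    Measure.restrict_apply_univ, Complex.volume_ball] at hH
  have h0 := (enorm_le_lintegral_ball hf hR hsub).trans hH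
  have h1 : (∫⁻ w in ball z R, ‖f w‖ₑ ^ p) ^ (1 / p) ≤
      ENNReal.ofReal ((Real.pi * R ^ (-μ)) ^ (1 / p)) * bnorm p μ f := by
    refine (ENNReal.rpow_le_rpow hle (by positivity)).trans ?_
    rw [ENNReal.mul_rpow_of_nonneg _ _ (by positivity), ← ENNReal.rpow_mul,
      mul_one_div_cancel hp0.ne', ENNReal.rpow_one,
      ENNReal.ofReal_rpow_of_nonneg (by positivity) (by positivity)]
  have h2 : (ENNReal.ofReal R ^ 2 * (NNReal.pi : ℝ≥0∞)) ^ (1 / p.conjExponent) =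
      ENNReal.ofReal ((R ^ 2 * Real.pi) ^ (1 - 1 / p)) := by
    have : (1 : ℝ) / p.conjExponent = 1 - 1 / p := by
      rw [one_div, one_div]; exact (hq.one_sub_inv).symm
    rw [this, ← ENNReal.ofReal_rpow_of_nonneg (by positivity), ENNReal.ofReal_mul (by positivity),
      ENNReal.ofReal_pow hR.le]
    · congr 2
      rw [← NNReal.coe_real_pi, ENNReal.ofReal_coe_nnreal]
    · rw [sub_nonneg, div_le_one hp0]; exact hp.le
  rw [h2] at h0
  have h3 := h0.trans (mul_le_mul_left h1 _)
  have h4 : (R ^ 2)⁻¹ * ((Real.pi * R ^ (-μ)) ^ (1 / p) * (R ^ 2 * Real.pi) ^ (1 - 1 / p)) =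
      Real.pi * R ^ (-((2 + μ) / p)) := by
    rw [Real.mul_rpow Real.pi_pos.le (by positivity), Real.mul_rpow (by positivity) Real.pi_pos.le,
      ← Real.rpow_mul hR.le, ← Real.rpow_natCast R 2, ← Real.rpow_mul hR.le, ← Real.rpow_neg hR.le]
    have e1 : Real.pi ^ (1 / p) * Real.pi ^ (1 - 1 / p) = Real.pi := by
      rw [← Real.rpow_add Real.pi_pos]; simp
    have e2 : R ^ (-((2 : ℕ) : ℝ)) * (R ^ (-μ * (1 / p)) * R ^ (((2 : ℕ) : ℝ) * (1 - 1 / p))) =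
        R ^ (-((2 + μ) / p)) := by
      rw [← Real.rpow_add hR, ← Real.rpow_add hR]
      congr 1
      push_cast
      ring
    rw [← e2]
    nth_rewrite 3 [← e1]
    ring
  rw [← h4, ENNReal.ofReal_mul (by positivity), ENNReal.ofReal_mul (by positivity),
    ENNReal.ofReal_inv_of_pos (by positivity), mul_assoc]
  have h5 : (ENNReal.ofReal (R ^ 2))⁻¹ * (ENNReal.ofReal (R ^ 2) * ‖f z‖ₑ) = ‖f z‖ₑ := by
    rw [← mul_assoc, ENNReal.inv_mul_cancel (by simp [hR.ne']) ENNReal.ofReal_ne_top, one_mul]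
  rw [← h5]
  refine mul_le_mul_right (h3.trans (le_of_eq ?_)) _
  ring

/-! ### Radial averages and the differential equation of the Cesàro operator. -/

/-- The radial averaging operator `q ↦ ∫_0^1 t^β q(t z) dt`. -/
noncomputable def radial (β : ℂ) (q : ℂ → ℂ) (z : ℂ) : ℂ :=
  ∫ t in (0 : ℝ)..1, (t : ℂ) ^ β * q (t * z)

lemma ofReal_mul_mem_ball {z : ℂ} (hz : z ∈ ball (0 : ℂ) 1) {t : ℝ} (ht : t ∈ Icc (0 : ℝ) 1) :
    (t : ℂ) * z ∈ ball (0 : ℂ) 1 := by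
  rw [mem_ball_zero_iff] at *
  rw [norm_mul, Complex.norm_of_nonneg ht.1]
  nlinarith [norm_nonneg z, ht.1, ht.2]

lemma one_sub_ne_zero_of_mem_ball {z : ℂ} (hz : z ∈ ball (0 : ℂ) 1) : 1 - z ≠ 0 := by
  intro h
  rw [mem_ball_zero_iff, ← sub_eq_zero.1 h] at hz
  simp at hz

lemma continuousOn_comp_ray {q : ℂ → ℂ} (hq : ContinuousOn q (ball 0 1)) {z : ℂ}
    (hz : z ∈ ball (0 : ℂ) 1) : ContinuousOn (fun t : ℝ => q (t * z)) (Icc 0 1) :=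
  hq.comp (by fun_prop) fun _ ht => ofReal_mul_mem_ball hz ht

lemma intervalIntegrable_radial {β : ℂ} (hβ : 0 ≤ β.re) {q : ℂ → ℂ}
    (hq : ContinuousOn q (ball 0 1)) {z : ℂ} (hz : z ∈ ball (0 : ℂ) 1) :
    IntervalIntegrable (fun t : ℝ => (t : ℂ) ^ β * q (t * z)) volume 0 1 := by
  refine (intervalIntegral.intervalIntegrable_cpow' (by linarith)).mul_continuousOn ?_
  rw [uIcc_of_le zero_le_one]
  exact continuousOn_comp_ray hq hz

lemma hasDerivAt_radial {β : ℂ} (hβ : 0 ≤ β.re) {q : ℂ → ℂ}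
    (hq : DifferentiableOn ℂ q (ball 0 1)) {z : ℂ} (hz : z ∈ ball (0 : ℂ) 1) :
    HasDerivAt (radial β q) (∫ t in (0 : ℝ)..1, (t : ℂ) ^ β * (t * deriv q (t * z))) z := by
  have hd : ContinuousOn (deriv q) (ball 0 1) := (hq.deriv isOpen_ball).continuousOn
  have hz' := mem_ball_zero_iff.1 hz
  obtain ⟨ρ, hρ1, hρ2⟩ := exists_between hz'
  obtain ⟨M, hM⟩ := (isCompact_closedBall (0 : ℂ) ρ).exists_bound_of_continuousOn
    (hd.mono (closedBall_subset_ball hρ2))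
  have hmem : ∀ t ∈ Ioc (0 : ℝ) 1, ∀ x ∈ ball (0 : ℂ) ρ, (t : ℂ) * x ∈ closedBall (0 : ℂ) ρ := by
    intro t ht x hx
    rw [mem_ball_zero_iff] at hx
    rw [mem_closedBall_zero_iff, norm_mul, Complex.norm_of_nonneg ht.1.le]
    nlinarith [norm_nonneg x, ht.1, ht.2]
  have hcont : ∀ x ∈ ball (0 : ℂ) 1, AEStronglyMeasurable
      (fun t : ℝ => (t : ℂ) ^ β * q (t * x)) (volume.restrict (uIoc 0 1)) := fun x hx =>
    (intervalIntegrable_iff.1 (intervalIntegrable_radial hβ hq.continuousOn hx)).aestronglyMeasurable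
  refine (intervalIntegral.hasDerivAt_integral_of_dominated_loc_of_deriv_le
    (bound := fun _ => M) (s := ball (0 : ℂ) ρ)
    (F' := fun x t => (t : ℂ) ^ β * (t * deriv q (t * x)))
    (isOpen_ball.mem_nhds (mem_ball_zero_iff.2 hρ1)) ?_ ?_ ?_ ?_ ?_ ?_).2
  · filter_upwards [isOpen_ball.mem_nhds hz] with x hx using hcont x hx
  · exact intervalIntegrable_radial hβ hq.continuousOn hz
  · refine (intervalIntegrable_iff.1 ((intervalIntegral.intervalIntegrable_cpow'
      (by linarith)).mul_continuousOn ?_)).aestronglyMeasurable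
    rw [uIcc_of_le zero_le_one]
    exact (Complex.continuous_ofReal.continuousOn).mul (continuousOn_comp_ray hd hz)
  · refine Filter.Eventually.of_forall fun t ht x hx => ?_
    rw [uIoc_of_le zero_le_one] at ht
    have h1 := hM _ (hmem t ht x hx)
    rw [norm_mul, norm_mul, Complex.norm_cpow_eq_rpow_re_of_pos ht.1,
      Complex.norm_of_nonneg ht.1.le]
    have h2 : t ^ β.re ≤ 1 := Real.rpow_le_one ht.1.le ht.2 hβ
    have h3 : 0 ≤ t ^ β.re := Real.rpow_nonneg ht.1.le _
    calc t ^ β.re * (t * ‖deriv q (t * x)‖) ≤ 1 * (1 * M) := by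
          have ht0 := ht.1.le
          gcongr
          exact ht.2
      _ = M := by ring
  · exact intervalIntegrable_const
  · refine Filter.Eventually.of_forall fun t ht x hx => ?_
    rw [uIoc_of_le zero_le_one] at ht
    have h1 : (t : ℂ) * x ∈ ball (0 : ℂ) 1 := closedBall_subset_ball hρ2 (hmem t ht x hx)
    have h2 := (hq.differentiableAt (isOpen_ball.mem_nhds h1)).hasDerivAt
    have h3 : HasDerivAt (fun x : ℂ => (t : ℂ) * x) (t : ℂ) x := by
      simpa using (hasDerivAt_id x).const_mul (t : ℂ)
    have h4 := (h2.comp x h3).const_mul ((t : ℂ) ^ β)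
    rw [mul_comm (deriv q _)] at h4
    exact h4

lemma differentiableOn_radial {β : ℂ} (hβ : 0 ≤ β.re) {q : ℂ → ℂ}
    (hq : DifferentiableOn ℂ q (ball 0 1)) : DifferentiableOn ℂ (radial β q) (ball 0 1) :=
  fun _ hz => (hasDerivAt_radial hβ hq hz).differentiableAt.differentiableWithinAt

/-- The integrand is the t-derivative of t^(β+1) q(tz), which vanishes at t = 0 because Re(β+1) > 0.
Read for the radial average it gives the differential equation; read for a given solution it gives
uniqueness. -/
lemma integral_radial_by_parts {β : ℂ} (hβ : 0 ≤ β.re) {q : ℂ → ℂ}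
    (hq : DifferentiableOn ℂ q (ball 0 1)) {z : ℂ} (hz : z ∈ ball (0 : ℂ) 1) :
    ∫ t in (0 : ℝ)..1, ((β + 1) * ((t : ℂ) ^ β * q (t * z)) +
      z * ((t : ℂ) ^ β * (t * deriv q (t * z)))) = q z := by
  have hd : ContinuousOn (deriv q) (ball 0 1) := (hq.deriv isOpen_ball).continuousOn
  have hβ1 : 0 < (β + 1).re := by simp; linarith
  have hne : β + 1 ≠ 0 := fun h => by simp [h] at hβ1
  have := intervalIntegral.integral_eq_sub_of_hasDerivAt_of_le zero_le_one
    (f := fun t : ℝ => (t : ℂ) ^ (β + 1) * q (t * z))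
    (f' := fun t : ℝ => (β + 1) * ((t : ℂ) ^ β * q (t * z)) +
      z * ((t : ℂ) ^ β * (t * deriv q (t * z)))) ?_ ?_ ?_
  · rw [this]
    simp [Complex.zero_cpow hne]
  · exact (Complex.continuous_ofReal_cpow_const hβ1).continuousOn.mul
      (continuousOn_comp_ray hq.continuousOn hz)
  · intro t ht
    have h1 := ofReal_mul_mem_ball hz (Ioo_subset_Icc_self ht)
    have h2 := (hq.differentiableAt (isOpen_ball.mem_nhds h1)).hasDerivAt
    have h3 : HasDerivAt (fun t : ℝ => (t : ℂ) * z) z t := by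
      simpa using (Complex.ofRealCLM.hasDerivAt (x := t)).mul_const z
    have h4 := h2.comp t h3
    have h5 := hasDerivAt_ofReal_cpow_const ht.1.ne' hne
    refine (h5.mul h4).congr_deriv ?_
    have h0 : (t : ℂ) ≠ 0 := by simpa using ht.1.ne'
    rw [add_sub_cancel_right, Complex.cpow_add _ _ h0, Complex.cpow_one]
    simp only [Function.comp]
    ring
  · refine ((intervalIntegrable_radial hβ hq.continuousOn hz).const_mul _).add
      (IntervalIntegrable.const_mul ?_ z)
    refine (intervalIntegral.intervalIntegrable_cpow' (by linarith)).mul_continuousOn ?_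
    rw [uIcc_of_le zero_le_one]
    exact (Complex.continuous_ofReal.continuousOn).mul (continuousOn_comp_ray hd hz)

lemma radial_ode {β : ℂ} (hβ : 0 ≤ β.re) {q : ℂ → ℂ}
    (hq : DifferentiableOn ℂ q (ball 0 1)) {z : ℂ} (hz : z ∈ ball (0 : ℂ) 1) :
    (β + 1) * radial β q z + z * deriv (radial β q) z = q z := by
  have hd : ContinuousOn (deriv q) (ball 0 1) := (hq.deriv isOpen_ball).continuousOn
  rw [(hasDerivAt_radial hβ hq hz).deriv, ← integral_radial_by_parts hβ hq hz,
    intervalIntegral.integral_add, intervalIntegral.integral_const_mul,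
    intervalIntegral.integral_const_mul, radial]
  · exact (intervalIntegrable_radial hβ hq.continuousOn hz).const_mul _
  · refine IntervalIntegrable.const_mul ?_ z
    refine (intervalIntegral.intervalIntegrable_cpow' (by linarith)).mul_continuousOn ?_
    rw [uIcc_of_le zero_le_one]
    exact (Complex.continuous_ofReal.continuousOn).mul (continuousOn_comp_ray hd hz)

lemma radial_congr {β : ℂ} {q r : ℂ → ℂ} (h : ∀ w ∈ ball (0 : ℂ) 1, q w = r w) {z : ℂ}
    (hz : z ∈ ball (0 : ℂ) 1) : radial β q z = radial β r z := by
  refine intervalIntegral.integral_congr fun t ht => ?_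
  rw [uIcc_of_le zero_le_one] at ht
  simp only [h _ (ofReal_mul_mem_ball hz ht)]

/-- The factor z from dζ = z dt cancels 1/z, and at z = 0 the integrand is the constant f(0); the
removable singularity disappears in this form. -/
lemma cesaro_eq_radial (f : ℂ → ℂ) : cesaro f = radial 0 fun w => f w / (1 - w) := by
  ext z
  unfold cesaro radial
  split_ifs with hz
  · simp [hz]
  · rw [intervalIntegral.integral_mul_const]
    simp only [Complex.cpow_zero, one_mul]
    field_simp

lemma differentiableOn_div_one_sub {f : ℂ → ℂ} (hf : DifferentiableOn ℂ f (ball 0 1)) :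
    DifferentiableOn ℂ (fun w => f w / (1 - w)) (ball 0 1) :=
  hf.div (by fun_prop) fun _ hz => one_sub_ne_zero_of_mem_ball hz

lemma differentiableOn_cesaro {f : ℂ → ℂ} (hf : DifferentiableOn ℂ f (ball 0 1)) :
    DifferentiableOn ℂ (cesaro f) (ball 0 1) := by
  rw [cesaro_eq_radial]
  exact differentiableOn_radial (by simp) (differentiableOn_div_one_sub hf)

lemma cesaro_ode {f : ℂ → ℂ} (hf : DifferentiableOn ℂ f (ball 0 1)) {z : ℂ}
    (hz : z ∈ ball (0 : ℂ) 1) :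
    cesaro f z + z * deriv (cesaro f) z = f z / (1 - z) := by
  have := radial_ode (β := 0) (by simp) (differentiableOn_div_one_sub hf) hz
  rw [cesaro_eq_radial, ← this]
  ring

/-- The Cesàro transform is determined by its differential equation. -/
lemma eq_cesaro_of_ode {f F : ℂ → ℂ} (hF : DifferentiableOn ℂ F (ball 0 1))
    (h : ∀ z ∈ ball (0 : ℂ) 1, F z + z * deriv F z = f z / (1 - z)) {z : ℂ}
    (hz : z ∈ ball (0 : ℂ) 1) : cesaro f z = F z := by
  rw [cesaro_eq_radial, ← integral_radial_by_parts (β := 0) (by simp) hF hz]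
  refine intervalIntegral.integral_congr fun t ht => ?_
  rw [uIcc_of_le zero_le_one] at ht
  simp only [← h _ (ofReal_mul_mem_ball hz ht), Complex.cpow_zero]
  ring

lemma cesaro_congr {f g : ℂ → ℂ} (h : ∀ z ∈ ball (0 : ℂ) 1, f z = g z) {z : ℂ}
    (hz : z ∈ ball (0 : ℂ) 1) : cesaro f z = cesaro g z := by
  rw [cesaro_eq_radial, cesaro_eq_radial]
  exact radial_congr (fun w hw => by rw [h w hw]) hz

/-! ### Order of vanishing at the origin. -/

/-- `f` is `z ^ k` times an analytic function on the disc. -/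
def VanishesTo (k : ℕ) (f : ℂ → ℂ) : Prop :=
  ∃ h : ℂ → ℂ, DifferentiableOn ℂ h (ball 0 1) ∧ ∀ z ∈ ball (0 : ℂ) 1, f z = z ^ k * h z

lemma radial_zero_right (k : ℕ) (q : ℂ → ℂ) : radial k q 0 = q 0 / (k + 1) := by
  unfold radial
  simp only [mul_zero, Complex.cpow_natCast]
  rw [intervalIntegral.integral_mul_const]
  have : ∫ t in (0 : ℝ)..1, (t : ℂ) ^ k = 1 / ((k : ℂ) + 1) := by
    have := integral_pow (a := 0) (b := 1) k
    rw [show (fun t : ℝ => (t : ℂ) ^ k) = fun t : ℝ => ((t ^ k : ℝ) : ℂ) by ext; push_cast; rfl,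
      intervalIntegral.integral_ofReal, this]
    push_cast
    simp
  rw [this]
  ring

/-- Since (tz)^k = t^k z^k, the Cesàro operator preserves the order of vanishing. The cofactor at 0
is multiplied by ∫_0^1 t^k dt = 1/(k+1), the source of the exceptional points. -/
lemma cesaro_pow_mul {k : ℕ} {f h : ℂ → ℂ} (hf : ∀ z ∈ ball (0 : ℂ) 1, f z = z ^ k * h z)
    {z : ℂ} (hz : z ∈ ball (0 : ℂ) 1) :
    cesaro f z = z ^ k * radial k (fun w => h w / (1 - w)) z := by
  rw [cesaro_eq_radial, radial, radial, ← intervalIntegral.integral_const_mul]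
  refine intervalIntegral.integral_congr fun t ht => ?_
  rw [uIcc_of_le zero_le_one] at ht
  simp only [hf _ (ofReal_mul_mem_ball hz ht), Complex.cpow_zero, Complex.cpow_natCast]
  ring

lemma vanishesTo_succ {k : ℕ} {f h : ℂ → ℂ} (hh : DifferentiableOn ℂ h (ball 0 1))
    (hf : ∀ z ∈ ball (0 : ℂ) 1, f z = z ^ k * h z) (h0 : h 0 = 0) : VanishesTo (k + 1) f := by
  refine ⟨dslope h 0,
    (Complex.differentiableOn_dslope (isOpen_ball.mem_nhds (mem_ball_self one_pos))).2 hh,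
    fun z hz => ?_⟩
  have := sub_smul_dslope h 0 z
  rw [h0, sub_zero, sub_zero, smul_eq_mul] at this
  rw [hf z hz, ← this]
  ring

lemma VanishesTo.mono {k l : ℕ} (hkl : l ≤ k) {f : ℂ → ℂ} (h : VanishesTo k f) :
    VanishesTo l f := by
  obtain ⟨h, hh, hf⟩ := h
  refine ⟨fun z => z ^ (k - l) * h z, by fun_prop, fun z hz => ?_⟩
  rw [hf z hz, ← mul_assoc, ← pow_add, Nat.add_sub_cancel' hkl]

/-- A factor `z ^ k` can be cancelled at the origin. -/
lemma eq_of_pow_mul_eq {k : ℕ} {a b : ℂ → ℂ} (ha : ContinuousAt a 0) (hb : ContinuousAt b 0)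
    (h : ∀ z ∈ ball (0 : ℂ) 1, z ^ k * a z = z ^ k * b z) : a 0 = b 0 := by
  have h1 : Filter.Tendsto a (𝓝[≠] 0) (𝓝 (a 0)) := ha.tendsto.mono_left nhdsWithin_le_nhds
  have h2 : Filter.Tendsto b (𝓝[≠] 0) (𝓝 (b 0)) := hb.tendsto.mono_left nhdsWithin_le_nhds
  refine tendsto_nhds_unique (h1.congr' ?_) h2
  filter_upwards [self_mem_nhdsWithin,
    nhdsWithin_le_nhds (isOpen_ball.mem_nhds (mem_ball_self (x := (0 : ℂ)) one_pos))] with z hz hz1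
  exact mul_left_cancel₀ (pow_ne_zero k hz) (h z hz1)

lemma continuousAt_zero_of_differentiableOn {a : ℂ → ℂ} (ha : DifferentiableOn ℂ a (ball 0 1)) :
    ContinuousAt a 0 :=
  (ha.differentiableAt (isOpen_ball.mem_nhds (mem_ball_self one_pos))).continuousAt

/-- The leading coefficient of `λ f - C f` for `f = z ^ k h`. -/
lemma leading_coeff {k : ℕ} {lam : ℂ} {f g h b : ℂ → ℂ} (hh : DifferentiableOn ℂ h (ball 0 1))
    (hb : DifferentiableOn ℂ b (ball 0 1)) (hf : ∀ z ∈ ball (0 : ℂ) 1, f z = z ^ k * h z)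
    (hg : ∀ z ∈ ball (0 : ℂ) 1, g z = z ^ k * b z)
    (hfg : ∀ z ∈ ball (0 : ℂ) 1, lam * f z - cesaro f z = g z) :
    (lam - 1 / ((k : ℂ) + 1)) * h 0 = b 0 := by
  have hr := differentiableOn_radial (β := k) (by simp) (differentiableOn_div_one_sub hh)
  have := eq_of_pow_mul_eq (k := k) (a := fun z => lam * h z - radial k (fun w => h w / (1 - w)) z)
    (b := b) (continuousAt_zero_of_differentiableOn (by fun_prop))
    (continuousAt_zero_of_differentiableOn hb) (fun z hz => by
      rw [← hg z hz, ← hfg z hz, cesaro_pow_mul hf hz, hf z hz]; ring)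
  rw [← this]
  simp only [radial_zero_right, sub_zero, div_one]
  ring

/-- By induction on the order: while g has no term in z^k, comparing leading coefficients gives (λ -
1/(k+1)) h(0) = 0, so the cofactor h gains another zero. -/
lemma vanishesTo_of_resolvent {N : ℕ} {lam : ℂ} {f g : ℂ → ℂ}
    (hf : DifferentiableOn ℂ f (ball 0 1)) (hg : VanishesTo N g)
    (hfg : ∀ z ∈ ball (0 : ℂ) 1, lam * f z - cesaro f z = g z)
    (hlam : ∀ k < N, lam ≠ 1 / ((k : ℂ) + 1)) : VanishesTo N f := by
  suffices ∀ k ≤ N, VanishesTo k f from this N le_rfl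
  intro k
  induction k with
  | zero => exact fun _ => ⟨f, hf, by simp⟩
  | succ k ih =>
    intro hk
    obtain ⟨h, hh, hfh⟩ := ih (by omega)
    obtain ⟨b, hb, hgb⟩ := hg.mono hk
    refine vanishesTo_succ hh hfh ?_
    have := leading_coeff (b := fun z => z * b z) hh (by fun_prop) hfh
      (fun z hz => by rw [hgb z hz]; ring) hfg
    rw [zero_mul] at this
    exact (mul_eq_zero.1 this).resolve_left (sub_ne_zero.2 (hlam k (by omega)))

/-! ### Geometry of the flow. -/

/-- The semiflow `q z / (1 - (1 - q) z)`, `0 < q ≤ 1`, of self-maps of the disc fixing `0` and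
`1`. -/
noncomputable def flow (q : ℝ) (z : ℂ) : ℂ := q * z / (1 - (1 - q) * z)

/-- The weighted composition operator associated with `flow`. -/
noncomputable def flowComp (q : ℝ) (g : ℂ → ℂ) (z : ℂ) : ℂ := g (flow q z) / (1 - (1 - q) * z)

section Flow

variable {q : ℝ} {z : ℂ}

lemma le_norm_flow_den (hq1 : q ≤ 1) (hz : z ∈ ball (0 : ℂ) 1) :
    q ≤ ‖1 - (1 - (q : ℂ)) * z‖ := by
  rw [mem_ball_zero_iff] at hz
  have h1 := norm_sub_norm_le (1 : ℂ) ((1 - (q : ℂ)) * z)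
  have h2 : ‖(1 - (q : ℂ)) * z‖ = (1 - q) * ‖z‖ := by
    rw [norm_mul, show (1 - (q : ℂ)) = ((1 - q : ℝ) : ℂ) by push_cast; rfl,
      Complex.norm_of_nonneg (by linarith)]
  rw [h2, norm_one] at h1
  nlinarith [norm_nonneg z]

lemma flow_den_ne_zero (hq : 0 < q) (hq1 : q ≤ 1) (hz : z ∈ ball (0 : ℂ) 1) :
    1 - (1 - (q : ℂ)) * z ≠ 0 :=
  norm_pos_iff.1 (hq.trans_le (le_norm_flow_den hq1 hz))

lemma norm_flow (hq : 0 < q) (z : ℂ) : ‖flow q z‖ = q * ‖z‖ / ‖1 - (1 - (q : ℂ)) * z‖ := by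
  rw [flow, norm_div, norm_mul, Complex.norm_of_nonneg hq.le]

/-- The difference of the two sides is exactly (1-q)|1-z|². This is a Schwarz–Pick type bound with
the explicit constant needed to compare the weights at z and at its image. -/
lemma flow_sq_le (hq : 0 < q) (hq1 : q ≤ 1) (hz : z ∈ ball (0 : ℂ) 1) :
    q * (1 - ‖z‖ ^ 2) ≤ ‖1 - (1 - (q : ℂ)) * z‖ ^ 2 * (1 - ‖flow q z‖ ^ 2) := by
  have h0 := norm_pos_iff.2 (flow_den_ne_zero hq hq1 hz)
  have h1 : ‖1 - (1 - (q : ℂ)) * z‖ ^ 2 * (1 - ‖flow q z‖ ^ 2) =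
      ‖1 - (1 - (q : ℂ)) * z‖ ^ 2 - q ^ 2 * ‖z‖ ^ 2 := by
    rw [norm_flow hq]
    field_simp
  rw [h1, ← Complex.normSq_eq_norm_sq, ← Complex.normSq_eq_norm_sq, Complex.normSq_apply,
    Complex.normSq_apply]
  simp only [Complex.sub_re, Complex.sub_im, Complex.mul_re, Complex.mul_im, Complex.one_re,
    Complex.one_im, Complex.ofReal_re, Complex.ofReal_im]
  nlinarith [mul_nonneg (sub_nonneg.2 hq1) (add_nonneg (sq_nonneg (1 - z.re)) (sq_nonneg z.im))]

lemma flow_mem_ball (hq : 0 < q) (hq1 : q ≤ 1) (hz : z ∈ ball (0 : ℂ) 1) :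
    flow q z ∈ ball (0 : ℂ) 1 := by
  have h1 := flow_sq_le hq hq1 hz
  have h0 := norm_pos_iff.2 (flow_den_ne_zero hq hq1 hz)
  rw [mem_ball_zero_iff] at *
  have h2 : 0 < q * (1 - ‖z‖ ^ 2) := mul_pos hq (by nlinarith [norm_nonneg z])
  have h3 : 0 < 1 - ‖flow q z‖ ^ 2 := by
    by_contra! h
    nlinarith [sq_nonneg ‖1 - (1 - (q : ℂ)) * z‖]
  nlinarith [norm_nonneg (flow q z)]

lemma hasDerivAt_flow (hq : 0 < q) (hq1 : q ≤ 1) (hz : z ∈ ball (0 : ℂ) 1) :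
    HasDerivAt (flow q) (q / (1 - (1 - q) * z) ^ 2) z := by
  have h0 := flow_den_ne_zero hq hq1 hz
  have h1 : HasDerivAt (fun z : ℂ => (q : ℂ) * z) q z := by
    simpa using (hasDerivAt_id z).const_mul (q : ℂ)
  have h2 : HasDerivAt (fun z : ℂ => 1 - (1 - (q : ℂ)) * z) (-(1 - (q : ℂ))) z := by
    simpa using ((hasDerivAt_id z).const_mul (1 - (q : ℂ))).const_sub 1
  refine (h1.div h2 h0).congr_deriv ?_
  field_simp
  ring

/-- The inverse Möbius map is w ↦ w/(q + (1-q)w); it is used in cross-multiplied form. -/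
lemma injOn_flow (hq : 0 < q) (hq1 : q ≤ 1) : InjOn (flow q) (ball 0 1) := by
  have key : ∀ z ∈ ball (0 : ℂ) 1, z * (q + (1 - q) * flow q z) = flow q z := by
    intro z hz
    have h0 := flow_den_ne_zero hq hq1 hz
    obtain ⟨d, hd⟩ : ∃ d, d = 1 - (1 - (q : ℂ)) * z := ⟨_, rfl⟩
    rw [flow, ← hd]
    rw [← hd] at h0
    field_simp
    rw [hd]
    ring
  intro z hz w hw hzw
  have h1 := key z hz
  have h2 := key w hw
  rw [← hzw] at h2
  have h3 : (q : ℂ) + (1 - q) * flow q z ≠ 0 := by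
    intro h
    rw [h, mul_zero] at h1
    rw [← h1] at h
    simp [hq.ne'] at h
  exact mul_right_cancel₀ h3 (h1.trans h2.symm)

end Flow

/-! ### Norm estimates for the weighted composition operators and their averages. -/

/-- Change of variables for injective holomorphic maps, as an inequality. -/
lemma lintegral_comp_holomorphic_le {φ φ' : ℂ → ℂ} {s t : Set ℂ} (hs : MeasurableSet s)
    (hφ : ∀ z ∈ s, HasDerivAt φ (φ' z) z) (hinj : InjOn φ s) (hst : MapsTo φ s t)
    (F : ℂ → ℝ≥0∞) :
    ∫⁻ z in s, ENNReal.ofReal (‖φ' z‖ ^ 2) * F (φ z) ≤ ∫⁻ z in t, F z := by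
  have h1 : ∀ z ∈ s, HasFDerivWithinAt φ (φ' z • (1 : ℂ →L[ℝ] ℂ)) s z := fun z hz =>
    (hφ z hz).complexToReal_fderiv.hasFDerivWithinAt
  -- The real determinant of multiplication by c is the field norm of c from ℂ to ℝ.
  have h2 : ∀ c : ℂ, |(c • (1 : ℂ →L[ℝ] ℂ)).det| = ‖c‖ ^ 2 := by
    intro c
    have : (c • (1 : ℂ →L[ℝ] ℂ)).det = Algebra.norm ℝ c := by
      rw [Algebra.norm_apply, ContinuousLinearMap.det]
      rfl
    rw [this, Algebra.norm_complex_apply, Complex.normSq_eq_norm_sq, abs_of_nonneg (by positivity)]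
  have h3 := lintegral_image_eq_lintegral_abs_det_fderiv_mul volume hs h1 hinj F
  simp only [h2] at h3
  rw [← h3]
  exact lintegral_mono_set hst.image_subset

/-- The Jacobian |φ_q'|² is placed on the right so that a change of variables finishes the estimate.
The denominator ρ = |1-(1-q)z| can be as small as q; the zero of order m compensates for this,
because |φ_q(z)| ≤ q/ρ. -/
lemma flowComp_pointwise {p μ : ℝ} (hp : 0 < p) (hμ : 0 ≤ μ) {m : ℕ}
    (hm : 2 * μ + 4 ≤ (m + 1) * p) {g h : ℂ → ℂ} (hg : ∀ z ∈ ball (0 : ℂ) 1, g z = z ^ m * h z)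
    {q : ℝ} (hq : 0 < q) (hq1 : q ≤ 1) {z : ℂ} (hz : z ∈ ball (0 : ℂ) 1) :
    (1 - ‖z‖) ^ μ * ‖flowComp q g z‖ ^ p ≤ 2 ^ μ * q ^ (2 + μ - p) *
      (‖(q : ℂ) / (1 - (1 - q) * z) ^ 2‖ ^ 2 * ((1 - ‖flow q z‖) ^ μ * ‖h (flow q z)‖ ^ p)) := by
  have hw := flow_mem_ball hq hq1 hz
  have hsq := flow_sq_le hq hq1 hz
  have hρq := le_norm_flow_den hq1 hz
  have hnf := norm_flow hq z
  rw [flowComp, norm_div, hg _ hw, norm_mul, norm_pow, norm_div, norm_pow,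
    Complex.norm_of_nonneg hq.le]
  set ρ := ‖1 - (1 - (q : ℂ)) * z‖ with hρ
  set w := flow q z
  rw [mem_ball_zero_iff] at hz hw
  have hρ0 : 0 < ρ := hq.trans_le hρq
  have hz0 := norm_nonneg z
  have hw0 := norm_nonneg w
  have hwle : ‖w‖ ≤ q / ρ := by
    rw [hnf]
    gcongr
    nlinarith
  have hx : 0 < q / ρ := by positivity
  have hx1 : q / ρ ≤ 1 := (div_le_one hρ0).2 hρq
  have h1 : 1 - ‖z‖ ≤ ρ ^ 2 / q * (2 * (1 - ‖w‖)) := by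
    rw [div_mul_eq_mul_div, le_div_iff₀ hq]
    have e1 : 1 - ‖z‖ ≤ 1 - ‖z‖ ^ 2 := by nlinarith
    have e2 : 1 - ‖w‖ ^ 2 ≤ 2 * (1 - ‖w‖) := by nlinarith [sq_nonneg (1 - ‖w‖)]
    nlinarith [sq_nonneg ρ]
  have h2 : (1 - ‖z‖) ^ μ ≤ (ρ ^ 2 / q) ^ μ * (2 ^ μ * (1 - ‖w‖) ^ μ) := by
    rw [← Real.mul_rpow (by norm_num) (by linarith), ← Real.mul_rpow (by positivity) (by linarith)]
    exact Real.rpow_le_rpow (by linarith) h1 hμ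
  have h3 : (‖w‖ ^ m * ‖h w‖ / ρ) ^ p ≤ (q / ρ) ^ (m * p) * (1 / ρ) ^ p * ‖h w‖ ^ p := by
    rw [Real.rpow_mul hx.le, ← Real.mul_rpow (by positivity) (by positivity),
      ← Real.mul_rpow (by positivity) (by positivity), Real.rpow_natCast]
    refine Real.rpow_le_rpow (by positivity) ?_ hp.le
    calc ‖w‖ ^ m * ‖h w‖ / ρ ≤ (q / ρ) ^ m * ‖h w‖ / ρ := by gcongr
      _ = _ := by ring
  have hW : 0 ≤ (1 - ‖w‖) ^ μ := Real.rpow_nonneg (by linarith) _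
  have h4 : (ρ ^ 2 / q) ^ μ * ((q / ρ) ^ (m * p) * (1 / ρ) ^ p) ≤
      q ^ (2 + μ - p) * (q / ρ ^ 2) ^ 2 := by
    -- After extracting |φ_q'|² = (q/ρ²)² and the power of q, what remains is q/ρ ≤ 1 to the
    -- exponent (m+1)p - (2μ+4), nonnegative by the choice of m. Writing q and ρ as exponentials
    -- reduces the identity to linear algebra in the exponents.
    have e : (ρ ^ 2 / q) ^ μ * ((q / ρ) ^ (m * p) * (1 / ρ) ^ p) =
        (q ^ (2 + μ - p) * (q / ρ ^ 2) ^ 2) * (q / ρ) ^ ((m + 1) * p - (2 * μ + 4)) := by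
      have lq : q = Real.exp (Real.log q) := (Real.exp_log hq).symm
      have lρ : ρ = Real.exp (Real.log ρ) := (Real.exp_log hρ0).symm
      generalize Real.log q = A at lq
      generalize Real.log ρ = B at lρ
      rw [lq, lρ, one_div, ← Real.exp_neg, ← Real.exp_nat_mul, ← Real.exp_sub, ← Real.exp_sub,
        ← Real.exp_sub, ← Real.exp_nat_mul]
      simp only [← Real.exp_mul, ← Real.exp_add]
      congr 1
      push_cast
      ring
    rw [e]
    exact mul_le_of_le_one_right (by positivity)
      (Real.rpow_le_one hx.le hx1 (by linarith))
  calc (1 - ‖z‖) ^ μ * (‖w‖ ^ m * ‖h w‖ / ρ) ^ p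
      ≤ ((ρ ^ 2 / q) ^ μ * (2 ^ μ * (1 - ‖w‖) ^ μ)) *
        ((q / ρ) ^ (m * p) * (1 / ρ) ^ p * ‖h w‖ ^ p) := by
        gcongr
    _ = ((ρ ^ 2 / q) ^ μ * ((q / ρ) ^ (m * p) * (1 / ρ) ^ p)) *
        (2 ^ μ * (1 - ‖w‖) ^ μ * ‖h w‖ ^ p) := by ring
    _ ≤ (q ^ (2 + μ - p) * (q / ρ ^ 2) ^ 2) * (2 ^ μ * (1 - ‖w‖) ^ μ * ‖h w‖ ^ p) := by
        gcongr
    _ = _ := by ring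

/-- The weighted composition operators contract functions vanishing to high order at `0`. -/
lemma lintegral_flowComp_le {p μ : ℝ} (hp : 0 < p) (hμ : 0 ≤ μ) {m : ℕ}
    (hm : 2 * μ + 4 ≤ (m + 1) * p) {g h : ℂ → ℂ} (hg : ∀ z ∈ ball (0 : ℂ) 1, g z = z ^ m * h z)
    {q : ℝ} (hq : 0 < q) (hq1 : q ≤ 1) :
    ∫⁻ z in ball (0 : ℂ) 1, ENNReal.ofReal ((1 - ‖z‖) ^ μ / Real.pi) * ‖flowComp q g z‖ₑ ^ p ≤
      ENNReal.ofReal (2 ^ μ * q ^ (2 + μ - p)) * bnorm p μ h ^ p := by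
  rw [bnorm_rpow hp]
  refine le_trans ?_ (mul_le_mul_right (lintegral_comp_holomorphic_le measurableSet_ball
    (fun z hz => hasDerivAt_flow hq hq1 hz) (injOn_flow hq hq1)
    (fun z hz => flow_mem_ball hq hq1 hz) _) _)
  rw [← lintegral_const_mul' _ _ ENNReal.ofReal_ne_top]
  refine setLIntegral_mono' measurableSet_ball fun z hz => ?_
  have h1 := flowComp_pointwise hp hμ hm hg hq hq1 hz
  have hw := mem_ball_zero_iff.1 (flow_mem_ball hq hq1 hz)
  have hz' := mem_ball_zero_iff.1 hz
  have hw1 : 0 ≤ (1 - ‖flow q z‖) ^ μ := Real.rpow_nonneg (by linarith) _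
  have hz1 : 0 ≤ (1 - ‖z‖) ^ μ := Real.rpow_nonneg (by linarith) _
  have e : ∀ c : ℂ, ‖c‖ₑ ^ p = ENNReal.ofReal (‖c‖ ^ p) := fun c => by
    rw [← ofReal_norm, ENNReal.ofReal_rpow_of_nonneg (norm_nonneg _) hp.le]
  rw [e, e, ← ENNReal.ofReal_mul (by positivity), ← ENNReal.ofReal_mul (by positivity),
    ← ENNReal.ofReal_mul (by positivity), ← ENNReal.ofReal_mul (by positivity)]
  refine ENNReal.ofReal_le_ofReal ?_
  have h2 := div_le_div_of_nonneg_right h1 Real.pi_pos.le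
  refine (le_of_eq ?_).trans (h2.trans (le_of_eq ?_)) <;> ring

lemma lintegral_rpow_lt_top {c : ℝ} (hc : -1 < c) :
    ∫⁻ q in Ioo (0 : ℝ) 1, ENNReal.ofReal (q ^ c) < ∞ := by
  have := (intervalIntegral.integrableOn_Ioo_rpow_iff (s := c) (zero_lt_one' ℝ)).2 hc
  refine lt_of_le_of_lt (lintegral_mono fun q => ?_) this.2
  rw [Real.enorm_eq_ofReal_abs]
  exact ENNReal.ofReal_le_ofReal (le_abs_self _)

lemma measurable_flowComp {g : ℂ → ℂ} (hg : Measurable g) :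
    Measurable fun x : ℂ × ℝ => flowComp x.2 g x.1 := by
  have h2 : Measurable fun x : ℂ × ℝ => 1 - (1 - (x.2 : ℂ)) * x.1 := by fun_prop
  have h1 : Measurable fun x : ℂ × ℝ => flow x.2 x.1 := by
    unfold flow
    exact Measurable.div (by fun_prop) h2
  exact (hg.comp h1).div h2

/-- Bergman norm estimate for functions dominated by a Mellin type average along the flow. -/
lemma bnorm_le_of_flow_average {p μ a : ℝ} (hp : 1 < p) (hμ : 0 ≤ μ) {m : ℕ}
    (hm : 2 * μ + 4 ≤ (m + 1) * p) (ha : a * p < 2 + μ) :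
    ∃ M : ℝ≥0∞, M ≠ ∞ ∧ ∀ u g h : ℂ → ℂ, Measurable g →
      (∀ z ∈ ball (0 : ℂ) 1, g z = z ^ m * h z) →
      (∀ z ∈ ball (0 : ℂ) 1,
        ‖u z‖ₑ ≤ ∫⁻ q in Ioo (0 : ℝ) 1, ENNReal.ofReal (q ^ (-a)) * ‖flowComp q g z‖ₑ) →
      bnorm p μ u ≤ M * bnorm p μ h := by
  have hp0 : 0 < p := by linarith
  have hc := Real.HolderConjugate.conjExponent hp
  set p' := p.conjExponent
  have hp' : 0 < p' := hc.symm.pos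
  -- η is half of the available margin (2+μ)/p - a. Hölder splits q^(-a) as q^(-a+1/p'-η) ·
  -- q^(-1/p'+η). The second factor contributes q^(-1+ηp'), and the first, after Tonelli and the
  -- bound q^(2+μ-p), contributes q^(-1+ηp); both are integrable at 0.
  set η := (2 + μ - a * p) / (2 * p) with hη
  have hη0 : 0 < η := by rw [hη]; apply div_pos <;> linarith
  have hηp : η * p = (2 + μ - a * p) / 2 := by rw [hη]; field_simp
  set A := ∫⁻ q in Ioo (0 : ℝ) 1, ENNReal.ofReal (q ^ (-1 + η * p'))
  set B := ∫⁻ q in Ioo (0 : ℝ) 1, ENNReal.ofReal (q ^ (-1 + η * p))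
  have hA : A ≠ ∞ := (lintegral_rpow_lt_top (by nlinarith [mul_pos hη0 hp'])).ne
  have hB : B ≠ ∞ := (lintegral_rpow_lt_top (by nlinarith [mul_pos hη0 hp0])).ne
  refine ⟨(A ^ (p / p') * (ENNReal.ofReal (2 ^ μ) * B)) ^ (1 / p), ?_, fun u g h hgm hg hu => ?_⟩
  · refine ENNReal.rpow_ne_top_of_nonneg (by positivity) (ENNReal.mul_ne_top ?_ ?_)
    · exact ENNReal.rpow_ne_top_of_nonneg (by positivity) hA
    · exact ENNReal.mul_ne_top ENNReal.ofReal_ne_top hB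
  have hmeas := measurable_flowComp hgm
  have hpt : ∀ z ∈ ball (0 : ℂ) 1, ‖u z‖ₑ ^ p ≤ A ^ (p / p') *
      ∫⁻ q in Ioo (0 : ℝ) 1,
        ENNReal.ofReal (q ^ (p * (-a + 1 / p' - η))) * ‖flowComp q g z‖ₑ ^ p := by
    intro z hz
    have hmz : Measurable fun q : ℝ => flowComp q g z :=
      hmeas.comp (g := fun x : ℂ × ℝ => flowComp x.2 g x.1) (f := fun q : ℝ => (z, q))
        (by fun_prop)
    have h1 := ENNReal.lintegral_mul_le_Lp_mul_Lq (volume.restrict (Ioo (0 : ℝ) 1)) hc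
      (f := fun q => ENNReal.ofReal (q ^ (-a + 1 / p' - η)) * ‖flowComp q g z‖ₑ)
      (g := fun q => ENNReal.ofReal (q ^ (-(1 / p') + η)))
      (by fun_prop) (by fun_prop)
    have h2 : ‖u z‖ₑ ≤ ∫⁻ q in Ioo (0 : ℝ) 1,
        ((fun q => ENNReal.ofReal (q ^ (-a + 1 / p' - η)) * ‖flowComp q g z‖ₑ) *
          fun q => ENNReal.ofReal (q ^ (-(1 / p') + η))) q := by
      refine (hu z hz).trans (le_of_eq (setLIntegral_congr_fun measurableSet_Ioo fun q hq => ?_))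
      have hq0 : 0 < q := hq.1
      simp only [Pi.mul_apply]
      rw [mul_right_comm, ← ENNReal.ofReal_mul (by positivity), ← Real.rpow_add hq0]
      congr 3
      ring
    have h3 := ENNReal.rpow_le_rpow (h2.trans h1) hp0.le
    refine h3.trans (le_of_eq ?_)
    rw [ENNReal.mul_rpow_of_nonneg _ _ hp0.le, ← ENNReal.rpow_mul, ← ENNReal.rpow_mul,
      one_div_mul_cancel hp0.ne', ENNReal.rpow_one, mul_comm, one_div_mul_eq_div]
    congr 1
    · congr 1
      refine setLIntegral_congr_fun measurableSet_Ioo fun q hq => ?_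
      rw [ENNReal.ofReal_rpow_of_nonneg (Real.rpow_nonneg hq.1.le _) hp'.le,
        ← Real.rpow_mul hq.1.le]
      congr 2
      field_simp
    · refine setLIntegral_congr_fun measurableSet_Ioo fun q hq => ?_
      rw [ENNReal.mul_rpow_of_nonneg _ _ hp0.le,
        ENNReal.ofReal_rpow_of_nonneg (Real.rpow_nonneg hq.1.le _) hp0.le,
        ← Real.rpow_mul hq.1.le, mul_comm p]
  suffices bnorm p μ u ^ p ≤ (A ^ (p / p') * (ENNReal.ofReal (2 ^ μ) * B)) * bnorm p μ h ^ p by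
    have h1 := ENNReal.rpow_le_rpow this (z := 1 / p) (by positivity)
    rwa [ENNReal.mul_rpow_of_nonneg _ _ (by positivity), ← ENNReal.rpow_mul, ← ENNReal.rpow_mul,
      mul_one_div_cancel hp0.ne', ENNReal.rpow_one, ENNReal.rpow_one] at h1
  have hAtop : A ^ (p / p') ≠ ∞ := ENNReal.rpow_ne_top_of_nonneg (by positivity) hA
  rw [bnorm_rpow hp0]
  calc ∫⁻ z in ball (0 : ℂ) 1, ENNReal.ofReal ((1 - ‖z‖) ^ μ / Real.pi) * ‖u z‖ₑ ^ p
      ≤ ∫⁻ z in ball (0 : ℂ) 1, A ^ (p / p') * ∫⁻ q in Ioo (0 : ℝ) 1,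
          ENNReal.ofReal (q ^ (p * (-a + 1 / p' - η))) *
            (ENNReal.ofReal ((1 - ‖z‖) ^ μ / Real.pi) * ‖flowComp q g z‖ₑ ^ p) := by
        refine setLIntegral_mono' measurableSet_ball fun z hz => ?_
        refine (mul_le_mul_right (hpt z hz) _).trans (le_of_eq ?_)
        rw [mul_left_comm, ← lintegral_const_mul' _ _ ENNReal.ofReal_ne_top]
        congr 1
        refine lintegral_congr fun q => ?_
        ring
    _ = A ^ (p / p') * ∫⁻ q in Ioo (0 : ℝ) 1, ENNReal.ofReal (q ^ (p * (-a + 1 / p' - η))) *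
          ∫⁻ z in ball (0 : ℂ) 1,
            (ENNReal.ofReal ((1 - ‖z‖) ^ μ / Real.pi) * ‖flowComp q g z‖ₑ ^ p) := by
        rw [lintegral_const_mul' _ _ hAtop, lintegral_lintegral_swap]
        · congr 1
          refine lintegral_congr fun q => ?_
          rw [lintegral_const_mul' _ _ ENNReal.ofReal_ne_top]
        · refine Measurable.aemeasurable ?_
          simp only [Function.uncurry_def]
          refine Measurable.mul (by fun_prop) (Measurable.mul (by fun_prop) ?_)
          exact hmeas.enorm.pow_const p
    _ ≤ A ^ (p / p') * ∫⁻ q in Ioo (0 : ℝ) 1, ENNReal.ofReal (q ^ (-1 + η * p)) *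
          (ENNReal.ofReal (2 ^ μ) * bnorm p μ h ^ p) := by
        refine mul_le_mul_right (setLIntegral_mono' measurableSet_Ioo fun q hq => ?_) _
        refine (mul_le_mul_right (lintegral_flowComp_le hp0 hμ hm hg hq.1 hq.2.le) _).trans
          (le_of_eq ?_)
        have hq0 : 0 < q := hq.1
        rw [← mul_assoc, ← mul_assoc, ← ENNReal.ofReal_mul (by positivity),
          ← ENNReal.ofReal_mul (by positivity)]
        congr 2
        rw [mul_left_comm, ← Real.rpow_add hq0, mul_comm]
        congr 2
        have e : (1 : ℝ) / p' = 1 - 1 / p := by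
          rw [one_div, one_div]; exact (hc.one_sub_inv).symm
        rw [e]
        have e2 : p * (-a + (1 - 1 / p) - η) = -a * p + p - 1 - η * p := by
          field_simp
          ring
        rw [e2, hηp]
        ring
    _ = _ := by
        rw [lintegral_mul_const _ (by fun_prop)]
        ring

/-! ### Norm inequalities and division by powers of z. -/

lemma bnorm_add_le {p μ : ℝ} (hp : 1 < p) {f g : ℂ → ℂ} (hf : f ∈ holo) (hg : g ∈ holo) :
    bnorm p μ (f + g) ≤ bnorm p μ f + bnorm p μ g :=
  eLpNorm_add_le (measurable_of_mem_holo hf).aestronglyMeasurable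
    (measurable_of_mem_holo hg).aestronglyMeasurable
    (by simpa using ENNReal.ofReal_le_ofReal hp.le)

lemma bnorm_smul (p μ : ℝ) (c : ℂ) (f : ℂ → ℂ) : bnorm p μ (c • f) = ‖c‖ₑ * bnorm p μ f :=
  eLpNorm_const_smul c f _ _

lemma bnorm_sub_le {p μ : ℝ} (hp : 1 < p) {f g : ℂ → ℂ} (hf : f ∈ holo) (hg : g ∈ holo) :
    bnorm p μ (f - g) ≤ bnorm p μ f + bnorm p μ g :=
  eLpNorm_sub_le (measurable_of_mem_holo hf).aestronglyMeasurable
    (measurable_of_mem_holo hg).aestronglyMeasurable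
    (by simpa using ENNReal.ofReal_le_ofReal hp.le)

lemma indicator_mem_holo {f : ℂ → ℂ} (hf : DifferentiableOn ℂ f (ball 0 1)) :
    (ball (0 : ℂ) 1).indicator f ∈ holo :=
  ⟨hf.congr fun _ hz => indicator_of_mem hz f, fun _ hz => indicator_of_notMem hz f⟩

/-- Division by `z ^ m` is bounded on the functions vanishing to order `m`. -/
lemma bnorm_div_pow_le {p μ : ℝ} (hp : 1 < p) (hμ : 0 ≤ μ) (m : ℕ) :
    ∃ M : ℝ≥0∞, M ≠ ∞ ∧ ∀ g ∈ holo, ∀ h : ℂ → ℂ, DifferentiableOn ℂ h (ball 0 1) →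
      (∀ z ∈ ball (0 : ℂ) 1, g z = z ^ m * h z) →
      bnorm p μ h ≤ M * bnorm p μ g ∧ ‖h 0‖ₑ ≤ M * bnorm p μ g := by
  have hp0 : 0 < p := by linarith
  obtain ⟨M₀, hM₀, hb⟩ := bnorm_le_of_bounded (p := p) hμ
  set K : ℝ≥0∞ := 2 ^ m * ENNReal.ofReal (Real.pi * ((1 - 1 / 2) / 2) ^ (-((2 + μ) / p))) with hK
  have hKtop : K ≠ ∞ := ENNReal.mul_ne_top (by simp) ENNReal.ofReal_ne_top
  have hM : 1 + 2 ^ m + M₀ * K + K ≠ ∞ := by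
    refine ENNReal.add_ne_top.2 ⟨ENNReal.add_ne_top.2 ⟨?_, ENNReal.mul_ne_top hM₀ hKtop⟩, hKtop⟩
    exact ENNReal.add_ne_top.2 ⟨by simp, by simp⟩
  refine ⟨1 + 2 ^ m + M₀ * K + K, hM, fun g hg h hh hgh => ?_⟩
  by_cases htop : bnorm p μ g = ∞
  · rw [htop, ENNReal.mul_top (by simp)]
    exact ⟨le_top, le_top⟩
  -- For |z| ≥ 1/2 the quotient is at most 2^m |g|; for |z| ≤ 1/2 the maximum principle transfers
  -- the pointwise bound from the circle |z| = 1/2, and this also bounds h(0).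
  have hs : ∀ z ∈ sphere (0 : ℂ) (1 / 2), ‖h z‖ ≤ (K * bnorm p μ g).toReal := by
    intro z hz
    have hz' : ‖z‖ = 1 / 2 := mem_sphere_zero_iff_norm.1 hz
    have hzb : z ∈ ball (0 : ℂ) 1 := by rw [mem_ball_zero_iff, hz']; norm_num
    have h1 := enorm_le_bnorm hp hμ hg hzb
    rw [hz'] at h1
    have h2 : ‖h z‖ₑ = 2 ^ m * ‖g z‖ₑ := by
      have : ‖h z‖ = 2 ^ m * ‖g z‖ := by
        rw [hgh z hzb, norm_mul, norm_pow, hz', ← mul_assoc, ← mul_pow]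
        norm_num
      rw [← ofReal_norm, this, ENNReal.ofReal_mul (by positivity), ofReal_norm,
        ENNReal.ofReal_pow (by norm_num)]
      simp
    rw [← toReal_enorm]
    refine ENNReal.toReal_mono (ENNReal.mul_ne_top hKtop htop) ?_
    rw [h2, hK, mul_assoc]
    exact mul_le_mul_right h1 _
  have hin : ∀ z ∈ closedBall (0 : ℂ) (1 / 2), ‖h z‖ ≤ (K * bnorm p μ g).toReal := by
    intro z hz
    refine Complex.norm_le_of_forall_mem_frontier_norm_le (U := ball (0 : ℂ) (1 / 2))
      isBounded_ball ?_ ?_ ?_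
    · refine (hh.mono ?_).diffContOnCl
      exact closure_ball_subset_closedBall.trans (closedBall_subset_ball (by norm_num))
    · rw [frontier_ball _ (by norm_num)]
      exact hs
    · rwa [closure_ball _ (by norm_num)]
  constructor
  · have h1 : bnorm p μ h ≤ bnorm p μ (fun z => (((2 ^ m * ‖g z‖ : ℝ) : ℂ)) +
        (((K * bnorm p μ g).toReal : ℝ) : ℂ)) := by
      refine bnorm_mono fun z hz => ?_
      rw [← Complex.ofReal_add, Complex.norm_of_nonneg (by positivity)]
      by_cases hz2 : ‖z‖ ≤ 1 / 2
      · have := hin z (mem_closedBall_zero_iff.2 hz2)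
        have : 0 ≤ 2 ^ m * ‖g z‖ := by positivity
        linarith
      · push Not at hz2
        have h3 : ‖h z‖ ≤ 2 ^ m * ‖g z‖ := by
          rw [hgh z hz, norm_mul, norm_pow, ← mul_assoc, ← mul_pow]
          exact le_mul_of_one_le_left (norm_nonneg _) (one_le_pow₀ (by linarith))
        have := @ENNReal.toReal_nonneg (K * bnorm p μ g)
        linarith
    have h2 : bnorm p μ (fun z => ((2 ^ m * ‖g z‖ : ℝ) : ℂ)) ≤ 2 ^ m * bnorm p μ g := by
      have : bnorm p μ ((2 ^ m : ℂ) • g) = 2 ^ m * bnorm p μ g := by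
        rw [bnorm_smul, enorm_pow]
        congr 2
        rw [← ofReal_norm]; simp
      rw [← this]
      refine bnorm_mono fun z _ => ?_
      rw [Complex.norm_of_nonneg (by positivity)]
      simp
    have h3 := hb (fun _ => (((K * bnorm p μ g).toReal : ℝ) : ℂ)) (K * bnorm p μ g).toReal
      (fun z _ => by rw [Complex.norm_of_nonneg ENNReal.toReal_nonneg])
    rw [ENNReal.ofReal_toReal (ENNReal.mul_ne_top hKtop htop)] at h3
    have hgm := measurable_of_mem_holo hg
    have h4 : bnorm p μ (fun z => (((2 ^ m * ‖g z‖ : ℝ) : ℂ)) +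
        (((K * bnorm p μ g).toReal : ℝ) : ℂ)) ≤ _ :=
      eLpNorm_add_le (by fun_prop) (by fun_prop) (by simpa using ENNReal.ofReal_le_ofReal hp.le)
    calc bnorm p μ h ≤ 2 ^ m * bnorm p μ g + M₀ * (K * bnorm p μ g) :=
          (h1.trans h4).trans (add_le_add h2 h3)
      _ = (2 ^ m + M₀ * K) * bnorm p μ g := by ring
      _ ≤ _ := by
          refine mul_le_mul_left ?_ _
          rw [add_assoc 1]
          exact le_add_right le_add_self
  · have h1 := hin 0 (mem_closedBall_self (by norm_num))
    have h2 : ‖h 0‖ₑ ≤ K * bnorm p μ g := by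
      rw [← ofReal_norm]
      exact (ENNReal.ofReal_le_ofReal h1).trans ENNReal.ofReal_toReal_le
    exact h2.trans (mul_le_mul_left le_add_self _)

/-! ### The resolvent equation integrated along the flow. -/

section FlowODE

variable {z : ℂ}

lemma hasDerivAt_flow_param {q : ℝ} (hd : 1 - (1 - (q : ℂ)) * z ≠ 0) :
    HasDerivAt (fun q : ℝ => flow q z) (z * (1 - z) / (1 - (1 - q) * z) ^ 2) q := by
  have h1 : HasDerivAt (fun q : ℝ => (q : ℂ) * z) z q := by
    simpa using (Complex.ofRealCLM.hasDerivAt (x := q)).mul_const z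
  have h2 : HasDerivAt (fun q : ℝ => 1 - (1 - (q : ℂ)) * z) z q := by
    have := (((Complex.ofRealCLM.hasDerivAt (x := q)).const_sub 1).mul_const z).const_sub 1
    simpa using this
  refine (h1.div h2 hd).congr_deriv ?_
  congr 1
  ring

/-- With φ = φ_q(z) and d = 1-(1-q)z one has q ∂_q φ = φ(1-φ) and q ∂_q(1/d) = -φ/d. Hence q ∂_q
(v(φ)/d) = ((1-φ)(v + φ v')(φ) - v(φ))/d, where the equation for v can be inserted; q^(1-γ) is then
an integrating factor. -/
lemma hasDerivAt_flowComp {v : ℂ → ℂ} (hv : DifferentiableOn ℂ v (ball 0 1))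
    (hz : z ∈ ball (0 : ℂ) 1) {γ : ℂ} (hγ : γ ≠ 1) {G : ℂ → ℂ}
    (hode : ∀ w ∈ ball (0 : ℂ) 1, v w + w * deriv v w = (γ * v w + G w) / (1 - w))
    {q : ℝ} (hq : 0 < q) (hq1 : q ≤ 1) :
    HasDerivAt (fun q : ℝ => (q : ℂ) ^ (1 - γ) * flowComp q v z)
      ((q : ℂ) ^ (-γ) * flowComp q G z) q := by
  have hd := flow_den_ne_zero hq hq1 hz
  have hw := flow_mem_ball hq hq1 hz
  have h1 : HasDerivAt (fun q : ℝ => 1 - (1 - (q : ℂ)) * z) z q := by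
    have := (((Complex.ofRealCLM.hasDerivAt (x := q)).const_sub 1).mul_const z).const_sub 1
    simpa using this
  have h2 := (hv.differentiableAt (isOpen_ball.mem_nhds hw)).hasDerivAt.comp q
    (hasDerivAt_flow_param hd)
  have h3 := hasDerivAt_ofReal_cpow_const hq.ne' (sub_ne_zero.2 hγ.symm)
  refine (h3.mul (h2.div h1 hd)).congr_deriv ?_
  have hq0 : (q : ℂ) ≠ 0 := by simpa using hq.ne'
  have e1 : (q : ℂ) ^ (1 - γ) = q * (q : ℂ) ^ (-γ) := by
    rw [sub_eq_add_neg, Complex.cpow_add _ _ hq0, Complex.cpow_one]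
  have e2 : G (flow q z) = (1 - flow q z) * (v (flow q z) + flow q z * deriv v (flow q z)) -
      γ * v (flow q z) := by
    rw [hode _ hw]
    field_simp [one_sub_ne_zero_of_mem_ball hw]
    ring
  simp only [flowComp, Function.comp, Pi.div_apply, e2]
  rw [e1, show 1 - γ - 1 = -γ by ring]
  generalize v (flow q z) = A
  generalize deriv v (flow q z) = B
  have e3 : flow q z = q * z / (1 - (1 - q) * z) := rfl
  rw [e3]
  obtain ⟨d, hdd⟩ : ∃ d, d = 1 - (1 - (q : ℂ)) * z := ⟨_, rfl⟩
  rw [← hdd] at hd ⊢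
  have e4 : (1 : ℂ) - z = d - q * z := by rw [hdd]; ring
  rw [e4]
  field_simp
  ring

/-- Since φ_q(z) = O(q), the product is O(q^(m+1-Re γ)): the zero of v at the origin removes the
boundary term at q = 0. -/
lemma tendsto_flowComp_zero {v k : ℂ → ℂ} (hk : DifferentiableOn ℂ k (ball 0 1)) {m : ℕ}
    (hvk : ∀ w ∈ ball (0 : ℂ) 1, v w = w ^ m * k w) (hz : z ∈ ball (0 : ℂ) 1) {γ : ℂ}
    (hγ : γ.re < m + 1) :
    Filter.Tendsto (fun q : ℝ => (q : ℂ) ^ (1 - γ) * flowComp q v z) (𝓝[>] 0) (𝓝 0) := by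
  have hre : 0 < ((m : ℂ) + 1 - γ).re := by simp; linarith
  have hd : ContinuousAt (fun q : ℝ => 1 - (1 - (q : ℂ)) * z) 0 := by fun_prop
  have hd0 : 1 - (1 - ((0 : ℝ) : ℂ)) * z ≠ 0 := by
    simpa using one_sub_ne_zero_of_mem_ball hz
  have hflow0 : flow 0 z = 0 := by simp [flow]
  have hflow : ContinuousAt (fun q : ℝ => flow q z) 0 := (hasDerivAt_flow_param hd0).continuousAt
  have hk0 : ContinuousAt (fun q : ℝ => k (flow q z)) 0 := by
    refine ContinuousAt.comp ?_ hflow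
    rw [hflow0]
    exact continuousAt_zero_of_differentiableOn hk
  have h1 : ContinuousAt (fun q : ℝ => (q : ℂ) ^ ((m : ℂ) + 1 - γ) *
      ((z / (1 - (1 - (q : ℂ)) * z)) ^ m * k (flow q z) / (1 - (1 - (q : ℂ)) * z))) 0 :=
    (Complex.continuous_ofReal_cpow_const hre).continuousAt.mul
      ((((continuousAt_const.div hd hd0).pow m).mul hk0).div hd hd0)
  have h2 := h1.tendsto.mono_left (nhdsWithin_le_nhds (s := Ioi 0))
  have hne : (m : ℂ) + 1 - γ ≠ 0 := fun h => by simp [h] at hre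
  simp only [Complex.ofReal_zero, Complex.zero_cpow hne, zero_mul] at h2
  refine h2.congr' ?_
  filter_upwards [Ioo_mem_nhdsGT (zero_lt_one' ℝ)] with q hq
  have hq0 : (q : ℂ) ≠ 0 := by simpa using hq.1.ne'
  rw [flowComp, hvk _ (flow_mem_ball hq.1 hq.2.le hz),
    show (m : ℂ) + 1 - γ = m + (1 - γ) by ring, Complex.cpow_add _ _ hq0, Complex.cpow_natCast]
  generalize k (flow q z) = A
  rw [flow]
  rw [div_pow, div_pow, mul_pow]
  ring

/-- Solutions of the resolvent equation are Mellin averages along the flow. -/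
lemma enorm_le_flow_average {v k G : ℂ → ℂ} (hv : DifferentiableOn ℂ v (ball 0 1))
    (hk : DifferentiableOn ℂ k (ball 0 1)) {m : ℕ}
    (hvk : ∀ w ∈ ball (0 : ℂ) 1, v w = w ^ m * k w) (hG : Measurable G) {γ : ℂ} (hγ1 : γ ≠ 1)
    (hγ : γ.re < m + 1)
    (hode : ∀ w ∈ ball (0 : ℂ) 1, v w + w * deriv v w = (γ * v w + G w) / (1 - w))
    (hz : z ∈ ball (0 : ℂ) 1) :
    ‖v z‖ₑ ≤ ∫⁻ q in Ioo (0 : ℝ) 1, ENNReal.ofReal (q ^ (-γ.re)) * ‖flowComp q G z‖ₑ := by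
  have heq : ∫⁻ q in Ioo (0 : ℝ) 1, ENNReal.ofReal (q ^ (-γ.re)) * ‖flowComp q G z‖ₑ =
      ∫⁻ q in Ioo (0 : ℝ) 1, ‖((q : ℝ) : ℂ) ^ (-γ) * flowComp q G z‖ₑ := by
    refine setLIntegral_congr_fun measurableSet_Ioo fun q hq => ?_
    simp only [enorm_mul]
    rw [← ofReal_norm ((q : ℂ) ^ (-γ)), Complex.norm_cpow_eq_rpow_re_of_pos hq.1, Complex.neg_re]
  rw [heq]
  have hmz : Measurable fun q : ℝ => flowComp q G z :=
    (measurable_flowComp hG).comp (g := fun x : ℂ × ℝ => flowComp x.2 G x.1)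
      (f := fun q : ℝ => (z, q)) (by fun_prop)
  -- If the right side is infinite there is nothing to prove; otherwise its finiteness is the
  -- integrability needed for the fundamental theorem of calculus on (0,1).
  by_cases htop : ∫⁻ q in Ioo (0 : ℝ) 1, ‖((q : ℝ) : ℂ) ^ (-γ) * flowComp q G z‖ₑ = ∞
  · rw [htop]; exact le_top
  have hint : IntegrableOn (fun q : ℝ => (q : ℂ) ^ (-γ) * flowComp q G z) (Ioo 0 1) :=
    ⟨Measurable.aestronglyMeasurable (by fun_prop), lt_top_iff_ne_top.2 htop⟩
  have h1 := intervalIntegral.integral_eq_sub_of_hasDerivAt_of_tendsto zero_lt_one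
    (fun q hq => hasDerivAt_flowComp hv hz hγ1 hode hq.1 hq.2.le)
    ((intervalIntegrable_iff_integrableOn_Ioo_of_le zero_le_one).2 hint)
    (tendsto_flowComp_zero hk hvk hz hγ)
    ((hasDerivAt_flowComp hv hz hγ1 hode zero_lt_one le_rfl).continuousAt.tendsto.mono_left
      nhdsWithin_le_nhds)
  have h2 : ((1 : ℝ) : ℂ) ^ (1 - γ) * flowComp 1 v z = v z := by
    simp [flowComp, flow]
  rw [h2, sub_zero, intervalIntegral.integral_of_le zero_le_one, integral_Ioc_eq_integral_Ioo] at h1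
  rw [← h1]
  exact enorm_integral_le_lintegral_enorm _

end FlowODE

/-! ### Boundedness of the Cesàro operator on A^p_μ. -/

/-- The Cesàro transform, extended by zero outside the disc. -/
noncomputable def cesaroExt (f : ℂ → ℂ) : ℂ → ℂ := (ball (0 : ℂ) 1).indicator (cesaro f)

/-- The monomial `z ^ k` on the disc, extended by zero. -/
noncomputable def monom (k : ℕ) : ℂ → ℂ := (ball (0 : ℂ) 1).indicator fun z => z ^ k

lemma monom_mem_holo (k : ℕ) : monom k ∈ holo := indicator_mem_holo (by fun_prop)

lemma monom_apply (k : ℕ) {z : ℂ} (hz : z ∈ ball (0 : ℂ) 1) : monom k z = z ^ k :=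
  indicator_of_mem hz _

lemma cesaroExt_mem_holo {f : ℂ → ℂ} (hf : f ∈ holo) : cesaroExt f ∈ holo :=
  indicator_mem_holo (differentiableOn_cesaro hf.1)

lemma cesaroExt_apply (f : ℂ → ℂ) {z : ℂ} (hz : z ∈ ball (0 : ℂ) 1) :
    cesaroExt f z = cesaro f z :=
  indicator_of_mem hz _

lemma holo_ext {f g : ℂ → ℂ} (hf : f ∈ holo) (hg : g ∈ holo)
    (h : ∀ z ∈ ball (0 : ℂ) 1, f z = g z) : f = g := by
  ext z
  by_cases hz : z ∈ ball (0 : ℂ) 1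
  · exact h z hz
  · rw [hf.2 z hz, hg.2 z hz]

lemma cesaroExt_add {f g : ℂ → ℂ} (hf : f ∈ holo) (hg : g ∈ holo) :
    cesaroExt (f + g) = cesaroExt f + cesaroExt g := by
  refine holo_ext (cesaroExt_mem_holo (holo.add_mem hf hg))
    (holo.add_mem (cesaroExt_mem_holo hf) (cesaroExt_mem_holo hg)) fun z hz => ?_
  rw [Pi.add_apply, cesaroExt_apply _ hz, cesaroExt_apply _ hz, cesaroExt_apply _ hz,
    cesaro_eq_radial, cesaro_eq_radial, cesaro_eq_radial, radial, radial, radial,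
    ← intervalIntegral.integral_add]
  · refine intervalIntegral.integral_congr fun t _ => ?_
    simp only [Pi.add_apply]
    ring
  · exact intervalIntegrable_radial (by simp) (differentiableOn_div_one_sub hf.1).continuousOn hz
  · exact intervalIntegrable_radial (by simp) (differentiableOn_div_one_sub hg.1).continuousOn hz

lemma cesaroExt_smul {f : ℂ → ℂ} (hf : f ∈ holo) (c : ℂ) :
    cesaroExt (c • f) = c • cesaroExt f := by
  refine holo_ext (cesaroExt_mem_holo (holo.smul_mem c hf))
    (holo.smul_mem c (cesaroExt_mem_holo hf)) fun z hz => ?_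
  rw [Pi.smul_apply, cesaroExt_apply _ hz, cesaroExt_apply _ hz,
    cesaro_eq_radial, cesaro_eq_radial, radial, radial, smul_eq_mul,
    ← intervalIntegral.integral_const_mul]
  refine intervalIntegral.integral_congr fun t _ => ?_
  simp only [Pi.smul_apply, smul_eq_mul]
  ring

/-- Since |1-tz| dominates both 1-t and 1-|z|, its inverse is split as the power 1-ε of one and the
power ε of the other. This replaces the true logarithmic growth by an arbitrarily small power. -/
lemma cesaro_pow_bound (k : ℕ) {ε : ℝ} (hε : 0 < ε) (hε1 : ε < 1) {z : ℂ}
    (hz : z ∈ ball (0 : ℂ) 1) :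
    ‖cesaro (fun w => w ^ k) z‖ ≤ (∫ t in (0 : ℝ)..1, (1 - t) ^ (ε - 1)) * (1 - ‖z‖) ^ (-ε) := by
  have hz1 : 0 < 1 - ‖z‖ := by rw [mem_ball_zero_iff] at hz; linarith
  have hint : IntervalIntegrable (fun t : ℝ => (1 - t) ^ (ε - 1)) volume 0 1 := by
    have := (intervalIntegral.intervalIntegrable_rpow' (a := 0) (b := 1) (r := ε - 1)
      (by linarith)).comp_sub_left 1
    simpa using this.symm
  rw [cesaro_eq_radial, ← intervalIntegral.integral_mul_const, radial]
  refine intervalIntegral.norm_integral_le_of_norm_le zero_le_one ?_ (hint.mul_const _)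
  have hne : ∀ᵐ t : ℝ, t ≠ 1 := by
    simp [ae_iff, measure_singleton]
  filter_upwards [hne] with t ht1 ht
  have htlt : t < 1 := lt_of_le_of_ne ht.2 ht1
  have hden : max (1 - t) (1 - ‖z‖) ≤ ‖1 - (t : ℂ) * z‖ := by
    have h1 := norm_sub_norm_le (1 : ℂ) (t * z)
    rw [norm_one, norm_mul, Complex.norm_of_nonneg ht.1.le] at h1
    refine max_le ?_ ?_ <;> nlinarith [norm_nonneg z, ht.1]
  have hd0 : 0 < ‖1 - (t : ℂ) * z‖ := hz1.trans_le ((le_max_right _ _).trans hden)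
  have hpow : ‖((t : ℂ) * z) ^ k‖ ≤ 1 := by
    rw [norm_pow]
    refine pow_le_one₀ (norm_nonneg _) ?_
    have := ofReal_mul_mem_ball hz ⟨ht.1.le, ht.2⟩
    rw [mem_ball_zero_iff] at this
    exact this.le
  have h1 : ‖1 - (t : ℂ) * z‖ ^ (ε - 1) ≤ (1 - t) ^ (ε - 1) :=
    Real.rpow_le_rpow_of_nonpos (by linarith) ((le_max_left _ _).trans hden) (by linarith)
  have h2 : ‖1 - (t : ℂ) * z‖ ^ (-ε) ≤ (1 - ‖z‖) ^ (-ε) :=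
    Real.rpow_le_rpow_of_nonpos hz1 ((le_max_right _ _).trans hden) (by linarith)
  rw [Complex.cpow_zero, one_mul, norm_div]
  calc ‖((t : ℂ) * z) ^ k‖ / ‖1 - (t : ℂ) * z‖ ≤ 1 / ‖1 - (t : ℂ) * z‖ := by gcongr
    _ = ‖1 - (t : ℂ) * z‖ ^ (ε - 1) * ‖1 - (t : ℂ) * z‖ ^ (-ε) := by
        rw [← Real.rpow_add hd0, show ε - 1 + -ε = -1 by ring, Real.rpow_neg_one, one_div]
    _ ≤ _ := by
        gcongr

lemma bnorm_cesaro_monom_lt_top {p μ : ℝ} (hp : 1 < p) (hμ : 0 < μ) (k : ℕ) :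
    bnorm p μ (cesaroExt (monom k)) < ∞ := by
  have hp0 : 0 < p := by linarith
  -- With εp ≤ μ the weight absorbs the p-th power of the bound (1-|z|)^(-ε).
  set ε := min (μ / p) (1 / 2)
  have hε : 0 < ε := lt_min (by positivity) (by norm_num)
  have hε1 : ε < 1 := (min_le_right _ _).trans_lt (by norm_num)
  have hεμ : ε * p ≤ μ := by
    have : ε ≤ μ / p := min_le_left _ _
    rwa [le_div_iff₀ hp0] at this
  set A := ∫ t in (0 : ℝ)..1, (1 - t) ^ (ε - 1)
  have hA : 0 ≤ A := intervalIntegral.integral_nonneg zero_le_one fun t ht =>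
    Real.rpow_nonneg (by linarith [ht.2]) _
  have key : bnorm p μ (cesaroExt (monom k)) ^ p < ∞ := by
    rw [bnorm_rpow hp0]
    refine lt_of_le_of_lt (setLIntegral_mono' measurableSet_ball (g := fun _ =>
      ENNReal.ofReal (A ^ p / Real.pi)) fun z hz => ?_) ?_
    · have hb := cesaro_pow_bound k hε hε1 hz
      have e : cesaroExt (monom k) z = cesaro (fun w => w ^ k) z := by
        rw [cesaroExt_apply _ hz]
        exact cesaro_congr (fun w hw => monom_apply k hw) hz
      have hz1 : 0 < 1 - ‖z‖ := by rw [mem_ball_zero_iff] at hz; linarith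
      rw [e, ← ofReal_norm, ENNReal.ofReal_rpow_of_nonneg (norm_nonneg _) hp0.le,
        ← ENNReal.ofReal_mul (by positivity)]
      refine ENNReal.ofReal_le_ofReal ?_
      calc (1 - ‖z‖) ^ μ / Real.pi * ‖cesaro (fun w => w ^ k) z‖ ^ p
          ≤ (1 - ‖z‖) ^ μ / Real.pi * (A * (1 - ‖z‖) ^ (-ε)) ^ p := by gcongr
        _ = A ^ p / Real.pi * (1 - ‖z‖) ^ (μ - ε * p) := by
            rw [Real.mul_rpow hA (by positivity), ← Real.rpow_mul hz1.le, Real.rpow_sub hz1,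
              neg_mul, Real.rpow_neg hz1.le]
            ring
        _ ≤ A ^ p / Real.pi * 1 := by
            gcongr
            exact Real.rpow_le_one hz1.le (by linarith [norm_nonneg z]) (by linarith)
        _ = _ := mul_one _
    · rw [setLIntegral_const]
      exact ENNReal.mul_lt_top ENNReal.ofReal_lt_top measure_ball_lt_top
  by_contra h
  rw [not_lt, top_le_iff] at h
  rw [h, ENNReal.top_rpow_of_pos hp0] at key
  exact lt_irrefl _ key

lemma bnorm_monom_lt_top {p μ : ℝ} (hμ : 0 ≤ μ) (k : ℕ) : bnorm p μ (monom k) < ∞ := by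
  obtain ⟨M, hM, h⟩ := bnorm_le_of_bounded (p := p) hμ
  refine (h (monom k) 1 fun z hz => ?_).trans_lt (by simpa using hM.lt_top)
  rw [monom_apply k hz, norm_pow]
  exact pow_le_one₀ (norm_nonneg _) (mem_ball_zero_iff.1 hz).le

lemma exists_order {p μ : ℝ} (hp : 1 < p) (a : ℝ) :
    ∃ m : ℕ, 1 ≤ m ∧ a ≤ m ∧ 2 * μ + 4 ≤ (m + 1) * p := by
  obtain ⟨m, hm⟩ := exists_nat_ge (max a (max 1 |2 * μ + 4|))
  have h1 := (le_max_left _ _).trans hm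
  have h2 := (le_max_right _ _).trans hm
  have h3 := (le_max_left _ _).trans h2
  have h4 := ((le_abs_self _).trans (le_max_right _ _)).trans h2
  refine ⟨m, by exact_mod_cast h3, h1, ?_⟩
  nlinarith

/-- The Cesàro operator is bounded on `A^p_μ`. -/
lemma bnorm_cesaroExt_le {p μ : ℝ} (hp : 1 < p) (hμ : 0 < μ) :
    ∃ M : ℝ≥0∞, M ≠ ∞ ∧ ∀ f ∈ holo, bnorm p μ (cesaroExt f) ≤ M * bnorm p μ f := by
  obtain ⟨m, hm1, -, hm⟩ := exists_order (μ := μ) hp 0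
  -- Descending induction on the order k of vanishing: order m is handled by the flow, and lower
  -- orders lose one monomial at a time.
  suffices ∀ j k : ℕ, k + j = m → ∃ M : ℝ≥0∞, M ≠ ∞ ∧ ∀ f ∈ holo, VanishesTo k f →
      bnorm p μ (cesaroExt f) ≤ M * bnorm p μ f by
    obtain ⟨M, hM, h⟩ := this m 0 (zero_add m)
    exact ⟨M, hM, fun f hf => h f hf ⟨f, hf.1, by simp⟩⟩
  intro j
  induction j with
  | zero =>
    rintro k hk
    obtain rfl : k = m := by omega
    -- The equation of the Cesàro transform is the case γ = 0 of the flow equation, with G = f.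
    obtain ⟨M₁, hM₁, h₁⟩ := bnorm_le_of_flow_average (a := 0) hp hμ.le hm (by linarith)
    obtain ⟨M₂, hM₂, h₂⟩ := bnorm_div_pow_le hp hμ.le k
    refine ⟨M₁ * M₂, ENNReal.mul_ne_top hM₁ hM₂, fun f hf ⟨h, hh, hfh⟩ => ?_⟩
    have h3 := h₁ (cesaro f) f h (measurable_of_mem_holo hf) hfh fun z hz => by
      have := enorm_le_flow_average (γ := 0) (differentiableOn_cesaro hf.1)
        (differentiableOn_radial (β := k) (by simp) (differentiableOn_div_one_sub hh))
        (fun w hw => cesaro_pow_mul hfh hw) (measurable_of_mem_holo hf) (by simp)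
        (by simp; positivity) (fun w hw => by rw [cesaro_ode hf.1 hw]; ring) hz
      simpa using this
    rw [bnorm_congr (g := cesaro f) fun z hz => cesaroExt_apply f hz, mul_assoc]
    exact h3.trans (mul_le_mul_right (h₂ f hf h hh hfh).1 _)
  | succ j ih =>
    intro k hk
    obtain ⟨M₁, hM₁, h₁⟩ := ih (k + 1) (by omega)
    obtain ⟨M₂, hM₂, h₂⟩ := bnorm_div_pow_le hp hμ.le k
    have hk1 := (bnorm_monom_lt_top (p := p) hμ.le k).ne
    have hk2 := (bnorm_cesaro_monom_lt_top hp hμ k).ne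
    refine ⟨M₁ * (1 + M₂ * bnorm p μ (monom k)) + M₂ * bnorm p μ (cesaroExt (monom k)), ?_,
      fun f hf ⟨h, hh, hfh⟩ => ?_⟩
    · exact ENNReal.add_ne_top.2 ⟨ENNReal.mul_ne_top hM₁ (ENNReal.add_ne_top.2
        ⟨ENNReal.one_ne_top, ENNReal.mul_ne_top hM₂ hk1⟩), ENNReal.mul_ne_top hM₂ hk2⟩
    have hc := (h₂ f hf h hh hfh).2
    have hmon := holo.smul_mem (h 0) (monom_mem_holo k)
    have hf1 : f - h 0 • monom k ∈ holo := holo.sub_mem hf hmon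
    have hv : VanishesTo (k + 1) (f - h 0 • monom k) :=
      vanishesTo_succ (h := fun z => h z - h 0) (by fun_prop) (fun z hz => by
        simp only [Pi.sub_apply, Pi.smul_apply, smul_eq_mul, monom_apply k hz, hfh z hz]
        ring) (sub_self _)
    have e : cesaroExt f = cesaroExt (f - h 0 • monom k) + h 0 • cesaroExt (monom k) := by
      rw [← cesaroExt_smul (monom_mem_holo k), ← cesaroExt_add hf1 hmon, sub_add_cancel]
    rw [e]
    calc _ ≤ bnorm p μ (cesaroExt (f - h 0 • monom k)) + bnorm p μ (h 0 • cesaroExt (monom k)) :=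
          bnorm_add_le hp (cesaroExt_mem_holo hf1)
            (holo.smul_mem _ (cesaroExt_mem_holo (monom_mem_holo k)))
      _ ≤ M₁ * (bnorm p μ f + M₂ * bnorm p μ f * bnorm p μ (monom k)) +
          M₂ * bnorm p μ f * bnorm p μ (cesaroExt (monom k)) := by
          refine add_le_add ((h₁ _ hf1 hv).trans (mul_le_mul_right
            ((bnorm_sub_le hp hf hmon).trans ?_) _)) ?_
          · rw [bnorm_smul]
            gcongr
          · rw [bnorm_smul]
            gcongr
      _ = _ := by ring

/-! ### Solving the resolvent equation with uniform bounds. -/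

/-- The resolvent equation has analytic solutions for right-hand sides of high order at `0`. -/
lemma exists_resolvent_holo {m : ℕ} {γ : ℂ} (hγm : γ.re ≤ m) {g h : ℂ → ℂ}
    (hh : DifferentiableOn ℂ h (ball 0 1))
    (hgh : ∀ z ∈ ball (0 : ℂ) 1, g z = z ^ m * h z) :
    ∃ v k : ℂ → ℂ, DifferentiableOn ℂ v (ball 0 1) ∧ DifferentiableOn ℂ k (ball 0 1) ∧
      (∀ z ∈ ball (0 : ℂ) 1, v z = z ^ m * k z) ∧
      ∀ z ∈ ball (0 : ℂ) 1, v z + z * deriv v z = (γ * v z + γ * g z) / (1 - z) := by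
  have hre : 0 ≤ ((m : ℂ) - γ).re := by simpa using hγm
  have hsl : ∀ z ∈ ball (0 : ℂ) 1, 1 - z ∈ Complex.slitPlane := fun z hz => by
    have h1 := Complex.re_le_norm z
    have h2 := mem_ball_zero_iff.1 hz
    exact Or.inl (by simp; linarith)
  have hpow : ∀ c : ℂ, DifferentiableOn ℂ (fun z : ℂ => (1 - z) ^ c) (ball 0 1) := fun c z hz =>
    ((differentiableAt_id.const_sub 1).cpow_const (hsl z hz)).differentiableWithinAt
  have hq : DifferentiableOn ℂ (fun z => (1 - z) ^ (γ - 1) * h z) (ball 0 1) := (hpow _).mul hh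
  -- Variation of constants from the homogeneous solution z^(γ-1) (1-z)^(-γ), integrated along the
  -- segment from 0 to z. Taking out z^m leaves only powers of 1 - z, analytic on the disc, and the
  -- factor t^(m-γ), bounded on (0,1] because Re γ ≤ m.
  set J := radial (m - γ) fun z => (1 - z) ^ (γ - 1) * h z with hJ
  have hJd : DifferentiableOn ℂ J (ball 0 1) := differentiableOn_radial hre hq
  have hkd : DifferentiableOn ℂ (fun z => γ * ((1 - z) ^ (-γ) * J z)) (ball 0 1) :=
    ((hpow _).mul hJd).const_mul γ
  refine ⟨fun z => z ^ m * (γ * ((1 - z) ^ (-γ) * J z)), fun z => γ * ((1 - z) ^ (-γ) * J z),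
    by fun_prop, hkd, fun _ _ => rfl, fun z hz => ?_⟩
  have hne := one_sub_ne_zero_of_mem_ball hz
  have hJz : HasDerivAt J (deriv J z) z :=
    (hJd.differentiableAt (isOpen_ball.mem_nhds hz)).hasDerivAt
  have hode : (m - γ + 1) * J z + z * deriv J z = (1 - z) ^ (γ - 1) * h z := radial_ode hre hq hz
  have hp1 : HasDerivAt (fun z : ℂ => (1 - z) ^ (-γ)) (γ * (1 - z) ^ (-γ - 1)) z := by
    have := ((hasDerivAt_id z).const_sub 1).cpow_const (c := -γ) (hsl z hz)
    refine this.congr_deriv ?_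
    simp
  have hD := (hasDerivAt_pow m z).mul ((hp1.mul hJz).const_mul γ)
  have hD' : deriv (fun z => z ^ m * (γ * ((1 - z) ^ (-γ) * J z))) z = _ := hD.deriv
  rw [hD', hgh z hz]
  simp only [Pi.mul_apply]
  have e1 : (1 - z) ^ (-γ - 1) = (1 - z) ^ (-γ) / (1 - z) := by
    rw [Complex.cpow_sub _ _ hne, Complex.cpow_one]
  have e2 : (1 - z) ^ (-γ) * ((1 - z) ^ (γ - 1) * (1 - z)) = 1 := by
    have : (1 - z) ^ (γ - 1) * (1 - z) = (1 - z) ^ γ := by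
      rw [Complex.cpow_sub _ _ hne, Complex.cpow_one, div_mul_cancel₀ _ hne]
    rw [this, ← Complex.cpow_add _ _ hne, neg_add_cancel, Complex.cpow_zero]
  have e3 : z * ((m : ℂ) * z ^ (m - 1)) = m * z ^ m := by
    rcases m with _ | m
    · simp
    · simp [pow_succ]; ring
  rw [e1, eq_div_iff hne]
  generalize (1 - z) ^ (-γ) = P at *
  generalize (1 - z) ^ (γ - 1) = Q at *
  generalize deriv J z = J' at *
  have hR : P / (1 - z) * (1 - z) = P := by field_simp
  generalize P / (1 - z) = R at *
  linear_combination γ * (P * J z) * (1 - z) * e3 + γ * z ^ m * (1 - z) * P * hode +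
    γ * z ^ m * h z * e2 + γ * z ^ m * z * γ * J z * hR

/-- The flow average with q^(-Re γ) is dominated by the one with q^(-r), which makes the constant
independent of λ. It converges because rp ≤ 2 + α < 2 + μ; equality in rp ≤ 2 + α is allowed, so the
boundary circle of D_r is covered apart from 0. -/
lemma exists_resolvent_of_high_order {p α r : ℝ} (hp : 1 < p) (hα : 0 < α)
    (hr : r * p ≤ 2 + α) {m : ℕ} (hrm : r ≤ m)
    (hm : 2 * (α + 1) + 4 ≤ (m + 1) * p) {δ : ℝ} (hδ : 0 < δ) :
    ∃ M : ℝ → ℝ≥0∞, (∀ μ, M μ ≠ ∞) ∧ ∀ lam : ℂ, δ ≤ ‖lam‖ → lam ≠ 1 → (1 / lam).re ≤ r →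
      ∀ g ∈ holo, VanishesTo m g → ∃ F ∈ holo,
        (∀ z ∈ ball (0 : ℂ) 1, lam * F z - cesaro F z = g z) ∧
        ∀ μ, α < μ → μ ≤ α + 1 → bnorm p μ F ≤ M μ * bnorm p μ g := by
  -- Restricting to μ ≤ α + 1 lets one order m serve all exponents; outside this range the constants
  -- are the irrelevant value 0.
  have hM : ∀ μ, ∃ M : ℝ≥0∞ × ℝ≥0∞, (M.1 ≠ ∞ ∧ M.2 ≠ ∞) ∧ (α < μ → μ ≤ α + 1 →
      (∀ u g h : ℂ → ℂ, Measurable g → (∀ z ∈ ball (0 : ℂ) 1, g z = z ^ m * h z) →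
      (∀ z ∈ ball (0 : ℂ) 1,
        ‖u z‖ₑ ≤ ∫⁻ q in Ioo (0 : ℝ) 1, ENNReal.ofReal (q ^ (-r)) * ‖flowComp q g z‖ₑ) →
      bnorm p μ u ≤ M.1 * bnorm p μ h) ∧
      (∀ g ∈ holo, ∀ h : ℂ → ℂ, DifferentiableOn ℂ h (ball 0 1) →
      (∀ z ∈ ball (0 : ℂ) 1, g z = z ^ m * h z) → bnorm p μ h ≤ M.2 * bnorm p μ g)) := by
    intro μ
    by_cases hμ : α < μ ∧ μ ≤ α + 1
    · obtain ⟨M₁, hM₁, h₁⟩ := bnorm_le_of_flow_average (μ := μ) (a := r) hp (by linarith)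
        (show 2 * μ + 4 ≤ (m + 1) * p by linarith) (by linarith)
      obtain ⟨M₂, hM₂, h₂⟩ := bnorm_div_pow_le (μ := μ) hp (by linarith) m
      exact ⟨(M₁, M₂), ⟨hM₁, hM₂⟩, fun _ _ => ⟨h₁, fun g hg h hh hgh => (h₂ g hg h hh hgh).1⟩⟩
    · exact ⟨(0, 0), by simp, fun h1 h2 => absurd ⟨h1, h2⟩ hμ⟩
  choose M hMtop hM using hM
  set D : ℝ≥0∞ := ENNReal.ofReal (1 / δ)
  refine ⟨fun μ => D * ((M μ).1 * (D * (M μ).2) + 1), fun μ => ?_,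
    fun lam hlam hlam1 hre g hg ⟨h, hh, hgh⟩ => ?_⟩
  · exact ENNReal.mul_ne_top ENNReal.ofReal_ne_top (ENNReal.add_ne_top.2
      ⟨ENNReal.mul_ne_top (hMtop μ).1 (ENNReal.mul_ne_top ENNReal.ofReal_ne_top (hMtop μ).2),
        ENNReal.one_ne_top⟩)
  have hlam0 : lam ≠ 0 := norm_pos_iff.1 (hδ.trans_le hlam)
  set γ := 1 / lam with hγ
  have hγ1 : γ ≠ 1 := fun h => hlam1 (by rw [hγ, div_eq_one_iff_eq hlam0] at h; exact h.symm)
  have hlg : lam * γ = 1 := mul_one_div_cancel hlam0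
  have hγD : ‖γ‖ₑ ≤ D := by
    rw [← ofReal_norm, hγ, norm_div, norm_one]
    exact ENNReal.ofReal_le_ofReal (one_div_le_one_div_of_le hδ hlam)
  obtain ⟨v, k, hv, hk, hvk, hode⟩ := exists_resolvent_holo (hre.trans hrm) hh hgh
  have hv' := indicator_mem_holo hv
  set v' := (ball (0 : ℂ) 1).indicator v with hv'def
  have hvv : ∀ z ∈ ball (0 : ℂ) 1, v' z = v z := fun z hz => indicator_of_mem hz _
  refine ⟨γ • (v' + g), holo.smul_mem _ (holo.add_mem hv' hg), fun z hz => ?_,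
    fun μ hμ1 hμ2 => ?_⟩
  · have : cesaro (γ • (v' + g)) z = v z := eq_cesaro_of_ode hv (fun w hw => by
      rw [hode w hw]
      simp only [Pi.smul_apply, Pi.add_apply, smul_eq_mul, hvv w hw]
      ring) hz
    rw [this]
    simp only [Pi.smul_apply, Pi.add_apply, smul_eq_mul, hvv z hz]
    linear_combination (v z + g z) * hlg
  · obtain ⟨h₁, h₂⟩ := hM μ hμ1 hμ2
    have hvb : bnorm p μ v' ≤ (M μ).1 * bnorm p μ (γ • h) := by
      refine h₁ v' (γ • g) (γ • h) ((measurable_of_mem_holo hg).const_smul γ) (fun z hz => by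
        simp only [Pi.smul_apply, smul_eq_mul, hgh z hz]; ring) fun z hz => ?_
      rw [hvv z hz]
      refine (enorm_le_flow_average hv hk hvk (G := γ • g)
        ((measurable_of_mem_holo hg).const_smul γ) hγ1 (by linarith) hode hz).trans ?_
      refine setLIntegral_mono' measurableSet_Ioo fun q hq => ?_
      exact mul_le_mul_left (ENNReal.ofReal_le_ofReal
        (Real.rpow_le_rpow_of_exponent_ge hq.1 hq.2.le (by linarith))) _
    rw [bnorm_smul] at hvb ⊢
    have hhb := h₂ g hg h hh hgh
    calc ‖γ‖ₑ * bnorm p μ (v' + g) ≤ D * (bnorm p μ v' + bnorm p μ g) :=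
          mul_le_mul' hγD (bnorm_add_le hp hv' hg)
      _ ≤ D * ((M μ).1 * (D * ((M μ).2 * bnorm p μ g)) + bnorm p μ g) := by
          refine mul_le_mul_right (add_le_add_left (hvb.trans ?_) _) _
          exact mul_le_mul_right (mul_le_mul' hγD hhb) _
      _ = _ := by ring

/-- Solvability of the resolvent equation, with bounds that are uniform in `lam`. -/
lemma exists_resolvent_bound {p α r : ℝ} (hp : 1 < p) (hα : 0 < α) (hr : r * p ≤ 2 + α) {m : ℕ}
    (hm1 : 1 ≤ m) (hrm : r ≤ m) (hm : 2 * (α + 1) + 4 ≤ (m + 1) * p) {δ : ℝ} (hδ : 0 < δ)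
    (R : ℝ) (j : ℕ) :
    ∀ k : ℕ, k + j = m → ∃ M : ℝ → ℝ≥0∞, (∀ μ, M μ ≠ ∞) ∧ ∀ lam : ℂ, δ ≤ ‖lam‖ → ‖lam‖ ≤ R →
      (1 / lam).re ≤ r → (∀ i < m, δ ≤ ‖lam - 1 / ((i : ℂ) + 1)‖) →
      ∀ g ∈ holo, VanishesTo k g → ∃ F ∈ holo,
        (∀ z ∈ ball (0 : ℂ) 1, lam * F z - cesaro F z = g z) ∧
        ∀ μ, α < μ → μ ≤ α + 1 → bnorm p μ F ≤ M μ * bnorm p μ g := by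
  induction j with
  | zero =>
    rintro k hk
    obtain rfl : k = m := by omega
    obtain ⟨M, hM, h⟩ := exists_resolvent_of_high_order hp hα hr hrm hm hδ
    refine ⟨M, hM, fun lam h1 _ h3 h4 => h lam h1 ?_ h3⟩
    -- λ = 1 is excluded by the distance condition at i = 0.
    rintro rfl
    have := h4 0 (by omega)
    simp at this
    linarith
  | succ j ih =>
    intro k hk
    obtain ⟨M₁, hM₁, h₁⟩ := ih (k + 1) (by omega)
    have hM : ∀ μ, ∃ M : ℝ≥0∞, M ≠ ∞ ∧ (α < μ → ∀ g ∈ holo, ∀ h : ℂ → ℂ,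
        DifferentiableOn ℂ h (ball 0 1) → (∀ z ∈ ball (0 : ℂ) 1, g z = z ^ k * h z) →
        ‖h 0‖ₑ ≤ M * bnorm p μ g) := by
      intro μ
      by_cases hμ : α < μ
      · obtain ⟨M, hM, h⟩ := bnorm_div_pow_le (μ := μ) hp (by linarith) k
        exact ⟨M, hM, fun _ g hg h' hh hgh => (h g hg h' hh hgh).2⟩
      · exact ⟨0, by simp, fun h => absurd h hμ⟩
    choose M₂ hM₂ h₂ using hM
    set D : ℝ≥0∞ := ENNReal.ofReal (1 / δ) with hD
    set S : ℝ≥0∞ := ENNReal.ofReal R with hS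
    -- The value 0 for μ ≤ α keeps the constant finite for every real μ, including those for which
    -- the norm may be infinite.
    set B : ℝ → ℝ≥0∞ := fun μ => if α < μ then bnorm p μ (monom k) else 0 with hB
    set B' : ℝ → ℝ≥0∞ := fun μ => if α < μ then bnorm p μ (cesaroExt (monom k)) else 0 with hB'
    have hBt : ∀ μ, B μ ≠ ∞ := fun μ => by
      rw [hB]; dsimp only; split_ifs with h
      · exact (bnorm_monom_lt_top (by linarith) k).ne
      · simp
    have hBt' : ∀ μ, B' μ ≠ ∞ := fun μ => by
      rw [hB']; dsimp only; split_ifs with h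
      · exact (bnorm_cesaro_monom_lt_top hp (by linarith) k).ne
      · simp
    refine ⟨fun μ => M₁ μ * (1 + D * M₂ μ * (S * B μ + B' μ)) + D * M₂ μ * B μ, fun μ => ?_,
      fun lam hl1 hl2 hl3 hl4 g hg ⟨h, hh, hgh⟩ => ?_⟩
    · have h1 : D * M₂ μ ≠ ∞ := ENNReal.mul_ne_top ENNReal.ofReal_ne_top (hM₂ μ)
      have h2 : S * B μ + B' μ ≠ ∞ := ENNReal.add_ne_top.2
        ⟨ENNReal.mul_ne_top ENNReal.ofReal_ne_top (hBt μ), hBt' μ⟩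
      exact ENNReal.add_ne_top.2 ⟨ENNReal.mul_ne_top (hM₁ μ) (ENNReal.add_ne_top.2
        ⟨ENNReal.one_ne_top, ENNReal.mul_ne_top h1 h2⟩), ENNReal.mul_ne_top h1 (hBt μ)⟩
    have hlk := hl4 k (by omega)
    have hne : lam - 1 / ((k : ℂ) + 1) ≠ 0 := norm_pos_iff.1 (hδ.trans_le hlk)
    -- λ z^k - C z^k has leading coefficient λ - 1/(k+1), so subtracting c times it from g cancels
    -- the term in z^k; and |c| ≤ |h(0)|/δ uniformly in λ.
    set c := h 0 / (lam - 1 / ((k : ℂ) + 1)) with hc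
    have hmon := monom_mem_holo k
    have hces := cesaroExt_mem_holo hmon
    have hsub := holo.sub_mem (holo.smul_mem lam hmon) hces
    have hg1 : g - c • (lam • monom k - cesaroExt (monom k)) ∈ holo :=
      holo.sub_mem hg (holo.smul_mem c hsub)
    have hrad : DifferentiableOn ℂ (radial k fun w => 1 / (1 - w)) (ball 0 1) :=
      differentiableOn_radial (by simp) (differentiableOn_div_one_sub (differentiableOn_const 1))
    have hv : VanishesTo (k + 1) (g - c • (lam • monom k - cesaroExt (monom k))) := by
      refine vanishesTo_succ
        (h := fun z => h z - c * (lam - radial k (fun w => 1 / (1 - w)) z)) (by fun_prop)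
        (fun z hz => ?_) ?_
      · have : cesaro (monom k) z = z ^ k * radial k (fun w => 1 / (1 - w)) z :=
          cesaro_pow_mul (h := fun _ => 1) (fun w hw => by rw [monom_apply k hw, mul_one]) hz
        simp only [Pi.sub_apply, Pi.smul_apply, smul_eq_mul, cesaroExt_apply _ hz, this,
          monom_apply k hz, hgh z hz]
        ring
      · simp only [radial_zero_right, sub_zero, div_one]
        rw [hc, div_mul_cancel₀ _ hne, sub_self]
    obtain ⟨F, hF, hFe, hFb⟩ := h₁ lam hl1 hl2 hl3 hl4 _ hg1 hv
    have hcm := holo.smul_mem c hmon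
    refine ⟨F + c • monom k, holo.add_mem hF hcm, fun z hz => ?_, fun μ hμ1 hμ2 => ?_⟩
    · have e := hFe z hz
      have e2 : cesaro (F + c • monom k) z = cesaro F z + c * cesaroExt (monom k) z := by
        rw [← cesaroExt_apply _ hz, cesaroExt_add hF hcm, cesaroExt_smul hmon, Pi.add_apply,
          cesaroExt_apply _ hz]
        rfl
      rw [e2]
      simp only [Pi.sub_apply, Pi.add_apply, Pi.smul_apply, smul_eq_mul] at e ⊢
      linear_combination e
    · have hcb : ‖c‖ₑ ≤ D * M₂ μ * bnorm p μ g := by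
        have e : ‖c‖ ≤ 1 / δ * ‖h 0‖ := by
          rw [hc, norm_div, one_div_mul_eq_div]
          gcongr
        have := ENNReal.ofReal_le_ofReal e
        rw [ofReal_norm, ENNReal.ofReal_mul (by positivity), ofReal_norm] at this
        rw [mul_assoc]
        exact this.trans (mul_le_mul_right (h₂ μ hμ1 g hg h hh hgh) _)
      have hls : ‖lam‖ₑ ≤ S := by
        rw [← ofReal_norm]; exact ENNReal.ofReal_le_ofReal hl2
      have eB : B μ = bnorm p μ (monom k) := if_pos hμ1
      have eB' : B' μ = bnorm p μ (cesaroExt (monom k)) := if_pos hμ1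
      have hb1 : bnorm p μ (g - c • (lam • monom k - cesaroExt (monom k))) ≤
          bnorm p μ g + D * M₂ μ * bnorm p μ g * (S * B μ + B' μ) := by
        refine (bnorm_sub_le hp hg (holo.smul_mem c hsub)).trans (add_le_add_right ?_ _)
        rw [bnorm_smul, eB, eB']
        refine mul_le_mul' hcb ((bnorm_sub_le hp (holo.smul_mem lam hmon) hces).trans ?_)
        rw [bnorm_smul]
        gcongr
      calc bnorm p μ (F + c • monom k) ≤ bnorm p μ F + bnorm p μ (c • monom k) :=
            bnorm_add_le hp hF hcm
        _ ≤ M₁ μ * (bnorm p μ g + D * M₂ μ * bnorm p μ g * (S * B μ + B' μ)) +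
            D * M₂ μ * bnorm p μ g * B μ := by
            refine add_le_add ((hFb μ hμ1 hμ2).trans (mul_le_mul_right hb1 _)) ?_
            rw [bnorm_smul, eB]
            gcongr
        _ = _ := by ring

/-! ### Behaviour at a boundary point. -/

/-- Membership in `A^p_μ` of functions with an algebraic singularity at one boundary point. -/
lemma bnorm_lt_top_of_le_rpow {p μ b : ℝ} (hp : 1 < p) (hμ : 0 ≤ μ) (hb : b * p < 2 + μ)
    {ξ : ℂ} (hξ : ‖ξ‖ = 1) {u : ℂ → ℂ} (hu : ∀ z ∈ ball (0 : ℂ) 1, ‖u z‖ ≤ ‖ξ - z‖ ^ (-b)) :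
    bnorm p μ u < ∞ := by
  have hp0 : 0 < p := by linarith
  have hint : IntegrableOn (fun x : ℂ => ‖x‖ ^ (-(b * p - μ))) (ball 0 2) volume := by
    refine integrableOn_ball_of_norm_le_rpow (C := 1) (α := b * p - μ) ?_ ?_ ?_ ?_
    · rw [Complex.finrank_real_complex]; norm_num
    · rw [Complex.finrank_real_complex]; push_cast; linarith
    · refine Filter.Eventually.of_forall fun x => ?_
      rw [one_mul, Real.norm_of_nonneg (Real.rpow_nonneg (norm_nonneg _) _)]
    · exact Measurable.aestronglyMeasurable (by fun_prop)
  have hfin : ∫⁻ x in ball (0 : ℂ) 2, ENNReal.ofReal (‖x‖ ^ (-(b * p - μ))) < ∞ := by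
    refine lt_of_le_of_lt (lintegral_mono fun q => ?_) hint.2
    rw [Real.enorm_eq_ofReal_abs]
    exact ENNReal.ofReal_le_ofReal (le_abs_self _)
  have key : bnorm p μ u ^ p < ∞ := by
    rw [bnorm_rpow hp0]
    calc ∫⁻ z in ball (0 : ℂ) 1, ENNReal.ofReal ((1 - ‖z‖) ^ μ / Real.pi) * ‖u z‖ₑ ^ p
        ≤ ∫⁻ z in ball (0 : ℂ) 1, (ball (0 : ℂ) 2).indicator
            (fun x => ENNReal.ofReal (‖x‖ ^ (-(b * p - μ)))) (ξ - z) := by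
          refine setLIntegral_mono' measurableSet_ball fun z hz => ?_
          have hz' := mem_ball_zero_iff.1 hz
          -- Replacing the weight by |ξ-z|^μ leaves the power |ξ-z|^(-(bp-μ)), integrable in the
          -- plane near ξ because bp - μ < 2.
          have h1 : 1 - ‖z‖ ≤ ‖ξ - z‖ := by
            have := norm_sub_norm_le ξ z
            rwa [hξ] at this
          have h0 : 0 < ‖ξ - z‖ := by linarith
          have h2 : ξ - z ∈ ball (0 : ℂ) 2 := by
            rw [mem_ball_zero_iff]
            have := norm_sub_le ξ z
            linarith
          have h3 : 0 ≤ (1 - ‖z‖) ^ μ := Real.rpow_nonneg (by linarith) _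
          rw [indicator_of_mem h2, ← ofReal_norm, ENNReal.ofReal_rpow_of_nonneg (norm_nonneg _)
            hp0.le, ← ENNReal.ofReal_mul (by positivity)]
          refine ENNReal.ofReal_le_ofReal ?_
          calc (1 - ‖z‖) ^ μ / Real.pi * ‖u z‖ ^ p
              ≤ ‖ξ - z‖ ^ μ / 1 * (‖ξ - z‖ ^ (-b)) ^ p := by
                gcongr
                · linarith [Real.pi_gt_three]
                · exact hu z hz
            _ = _ := by
                rw [div_one, ← Real.rpow_mul h0.le, ← Real.rpow_add h0]
                congr 1
                ring
      _ ≤ ∫⁻ z, (ball (0 : ℂ) 2).indicator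
            (fun x => ENNReal.ofReal (‖x‖ ^ (-(b * p - μ)))) (ξ - z) := setLIntegral_le_lintegral _ _
      _ = ∫⁻ x in ball (0 : ℂ) 2, ENNReal.ofReal (‖x‖ ^ (-(b * p - μ))) := by
          rw [lintegral_sub_left_eq_self (fun z => (ball (0 : ℂ) 2).indicator
            (fun x => ENNReal.ofReal (‖x‖ ^ (-(b * p - μ)))) z) ξ,
            lintegral_indicator measurableSet_ball]
      _ < ∞ := hfin
  by_contra h
  rw [not_lt, top_le_iff] at h
  rw [h, ENNReal.top_rpow_of_pos hp0] at key
  exact lt_irrefl _ key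

/-- Radial decay `(1 - t) ^ s f(t ξ) → 0` of functions in `A^p_μ`, for `s > (2 + μ) / p`. -/
lemma tendsto_radial_growth {p μ s : ℝ} (hp : 1 < p) (hμ : 0 ≤ μ) (hs : (2 + μ) / p < s)
    {f : ℂ → ℂ} (hf : f ∈ holo) (hb : bnorm p μ f < ∞) {ξ : ℂ} (hξ : ‖ξ‖ = 1) :
    Filter.Tendsto (fun t : ℝ => (1 - t) ^ s * ‖f (t * ξ)‖) (𝓝[<] 1) (𝓝 0) := by
  set κ := (2 + μ) / p
  set K := Real.pi * (2 : ℝ) ^ κ * (bnorm p μ f).toReal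
  have h1 : Filter.Tendsto (fun t : ℝ => K * (1 - t) ^ (s - κ)) (𝓝[<] 1) (𝓝 0) := by
    have hc : ContinuousAt (fun t : ℝ => K * (1 - t) ^ (s - κ)) 1 := by
      refine continuousAt_const.mul (ContinuousAt.rpow_const (by fun_prop) (Or.inr (by linarith)))
    have := hc.tendsto
    rw [sub_self, Real.zero_rpow (by linarith), mul_zero] at this
    exact this.mono_left nhdsWithin_le_nhds
  refine squeeze_zero' ?_ ?_ h1
  · filter_upwards [Ioo_mem_nhdsLT (zero_lt_one' ℝ)] with t ht
    exact mul_nonneg (Real.rpow_nonneg (by linarith [ht.2]) _) (norm_nonneg _)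
  · filter_upwards [Ioo_mem_nhdsLT (zero_lt_one' ℝ)] with t ht
    have hn : ‖(t : ℂ) * ξ‖ = t := by rw [norm_mul, Complex.norm_of_nonneg ht.1.le, hξ, mul_one]
    have hz : (t : ℂ) * ξ ∈ ball (0 : ℂ) 1 := by rw [mem_ball_zero_iff, hn]; exact ht.2
    have h2 := enorm_le_bnorm hp hμ hf hz
    have ht1 : 0 < 1 - t := by linarith [ht.2]
    rw [hn, ← ENNReal.ofReal_toReal hb.ne, ← ENNReal.ofReal_mul (by positivity), ← ofReal_norm,
      ENNReal.ofReal_le_ofReal_iff (by positivity), Real.div_rpow ht1.le (by norm_num),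
      Real.rpow_neg (by norm_num : (0 : ℝ) ≤ 2), div_inv_eq_mul] at h2
    calc (1 - t) ^ s * ‖f (t * ξ)‖ ≤ (1 - t) ^ s *
          (Real.pi * ((1 - t) ^ (-κ) * 2 ^ κ) * (bnorm p μ f).toReal) := by gcongr
      _ = K * ((1 - t) ^ s * (1 - t) ^ (-κ)) := by ring
      _ = _ := by rw [← Real.rpow_add ht1, ← sub_eq_add_neg]

/-! ### The integrating factor on (0,1): eigenvalues and non-surjectivity. -/

section RealAxis

variable {v g : ℂ → ℂ} {γ : ℂ}

lemma ofReal_mem_ball {t : ℝ} (ht : t ∈ Ioo (0 : ℝ) 1) : (t : ℂ) ∈ ball (0 : ℂ) 1 := by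
  rw [mem_ball_zero_iff, Complex.norm_of_nonneg ht.1.le]
  exact ht.2

/-- The resolvent equation on the real axis, with an integrating factor. -/
lemma hasDerivAt_integratingFactor (hv : DifferentiableOn ℂ v (ball 0 1))
    (hode : ∀ w ∈ ball (0 : ℂ) 1, v w + w * deriv v w = (γ * v w + γ * g w) / (1 - w))
    {t : ℝ} (ht : t ∈ Ioo (0 : ℝ) 1) :
    HasDerivAt (fun t : ℝ => (t : ℂ) ^ (1 - γ) * (1 - (t : ℂ)) ^ γ * v t)
      (γ * ((t : ℂ) ^ (-γ) * (1 - (t : ℂ)) ^ (γ - 1) * g t)) t := by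
  have htb := ofReal_mem_ball ht
  have ht0 : (t : ℂ) ≠ 0 := by simpa using ht.1.ne'
  have ht1 : 1 - (t : ℂ) ≠ 0 := one_sub_ne_zero_of_mem_ball htb
  have hs1 : (t : ℂ) ∈ Complex.slitPlane := Or.inl (by simpa using ht.1)
  have hs2 : 1 - (t : ℂ) ∈ Complex.slitPlane := Or.inl (by simpa using ht.2)
  have h1 := (hasDerivAt_id (t : ℂ)).cpow_const (c := 1 - γ) hs1
  have h2 := ((hasDerivAt_id (t : ℂ)).const_sub 1).cpow_const (c := γ) hs2
  have h3 := (hv.differentiableAt (isOpen_ball.mem_nhds htb)).hasDerivAt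
  have h4 := ((h1.mul h2).mul h3).comp_ofReal
  refine h4.congr_deriv ?_
  have e1 : (t : ℂ) ^ (1 - γ) = t * (t : ℂ) ^ (-γ) := by
    rw [sub_eq_add_neg, Complex.cpow_add _ _ ht0, Complex.cpow_one]
  have e2 : (1 - (t : ℂ)) ^ γ = (1 - (t : ℂ)) ^ (γ - 1) * (1 - t) := by
    rw [Complex.cpow_sub _ _ ht1, Complex.cpow_one, div_mul_cancel₀ _ ht1]
  have e3 := hode _ htb
  rw [eq_div_iff ht1] at e3
  simp only [Pi.mul_apply, id]
  rw [show 1 - γ - 1 = -γ by ring, e1, e2]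
  generalize (t : ℂ) ^ (-γ) = A
  generalize (1 - (t : ℂ)) ^ (γ - 1) = B
  linear_combination A * B * e3

/-- The zero of order m turns t^(1-γ) into t^(m+1-γ), a power with positive real part of the
exponent. -/
lemma tendsto_integratingFactor_zero {k : ℂ → ℂ} (hk : DifferentiableOn ℂ k (ball 0 1)) {m : ℕ}
    (hvk : ∀ w ∈ ball (0 : ℂ) 1, v w = w ^ m * k w) (hγ : γ.re < m + 1) :
    Filter.Tendsto (fun t : ℝ => (t : ℂ) ^ (1 - γ) * (1 - (t : ℂ)) ^ γ * v t)
      (𝓝[>] 0) (𝓝 0) := by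
  have hre : 0 < ((m : ℂ) + 1 - γ).re := by simp; linarith
  have hne : (m : ℂ) + 1 - γ ≠ 0 := fun h => by simp [h] at hre
  have hk0 : ContinuousAt (fun t : ℝ => k t) 0 :=
    ContinuousAt.comp (by simpa using continuousAt_zero_of_differentiableOn hk)
      Complex.continuous_ofReal.continuousAt
  have hc : ContinuousAt (fun t : ℝ => (1 - (t : ℂ)) ^ γ) 0 :=
    ContinuousAt.cpow (by fun_prop) continuousAt_const (by simp)
  have h1 : ContinuousAt (fun t : ℝ => (t : ℂ) ^ ((m : ℂ) + 1 - γ) * ((1 - (t : ℂ)) ^ γ * k t)) 0 :=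
    (Complex.continuous_ofReal_cpow_const hre).continuousAt.mul (hc.mul hk0)
  have h2 := h1.tendsto.mono_left (nhdsWithin_le_nhds (s := Ioi 0))
  simp only [Complex.ofReal_zero, Complex.zero_cpow hne, zero_mul] at h2
  refine h2.congr' ?_
  filter_upwards [Ioo_mem_nhdsGT (zero_lt_one' ℝ)] with t ht
  have ht0 : (t : ℂ) ≠ 0 := by simpa using ht.1.ne'
  rw [hvk _ (ofReal_mem_ball ht), show (m : ℂ) + 1 - γ = m + (1 - γ) by ring,
    Complex.cpow_add _ _ ht0, Complex.cpow_natCast]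
  ring

lemma tendsto_integratingFactor_one {s : ℝ} (hs : s = γ.re)
    (hv : Filter.Tendsto (fun t : ℝ => (1 - t) ^ s * ‖v t‖) (𝓝[<] 1) (𝓝 0)) :
    Filter.Tendsto (fun t : ℝ => (t : ℂ) ^ (1 - γ) * (1 - (t : ℂ)) ^ γ * v t)
      (𝓝[<] 1) (𝓝 0) := by
  have hc : ContinuousAt (fun t : ℝ => ‖(t : ℂ) ^ (1 - γ)‖) 1 :=
    (ContinuousAt.cpow (by fun_prop) continuousAt_const (by simp)).norm
  have h1 := (hc.tendsto.mono_left (nhdsWithin_le_nhds (s := Iio 1))).mul hv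
  rw [mul_zero] at h1
  refine tendsto_zero_iff_norm_tendsto_zero.2 (h1.congr' ?_)
  filter_upwards [Ioo_mem_nhdsLT (zero_lt_one' ℝ)] with t ht
  have : ‖(1 - (t : ℂ)) ^ γ‖ = (1 - t) ^ s := by
    rw [show 1 - (t : ℂ) = ((1 - t : ℝ) : ℂ) by push_cast; rfl,
      Complex.norm_cpow_eq_rpow_re_of_pos (by linarith [ht.2]), hs]
  rw [norm_mul, norm_mul, this]
  ring

end RealAxis

/-- Substitute f = (1/λ)(C f + g) into `cesaro_ode`; the unknown becomes C f instead of f. -/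
lemma resolvent_ode {lam : ℂ} (hlam : lam ≠ 0) {f g : ℂ → ℂ} (hf : DifferentiableOn ℂ f (ball 0 1))
    (hfg : ∀ z ∈ ball (0 : ℂ) 1, lam * f z - cesaro f z = g z) {w : ℂ} (hw : w ∈ ball (0 : ℂ) 1) :
    cesaro f w + w * deriv (cesaro f) w =
      ((1 / lam) * cesaro f w + (1 / lam) * g w) / (1 - w) := by
  rw [cesaro_ode hf hw, ← hfg w hw]
  congr 1
  field_simp
  ring

lemma eq_zero_of_eq_zero_on_Ioo {f : ℂ → ℂ} (hf : f ∈ holo)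
    (h : ∀ t ∈ Ioo (0 : ℝ) 1, f t = 0) : f = 0 := by
  refine holo_ext hf holo.zero_mem ?_
  have ha : AnalyticOnNhd ℂ f (ball 0 1) := hf.1.analyticOnNhd isOpen_ball
  have hhalf : ((1 / 2 : ℝ) : ℂ) ∈ ball (0 : ℂ) 1 := ofReal_mem_ball ⟨by norm_num, by norm_num⟩
  refine ha.eqOn_zero_of_preconnected_of_frequently_eq_zero
    (convex_ball (0 : ℂ) 1).isPreconnected hhalf ?_
  have h1 : Filter.Tendsto (fun t : ℝ => (t : ℂ)) (𝓝[>] (1 / 2)) (𝓝[≠] ((1 / 2 : ℝ) : ℂ)) := by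
    refine tendsto_nhdsWithin_of_tendsto_nhds_of_eventually_within _
      (Complex.continuous_ofReal.continuousAt.tendsto.mono_left nhdsWithin_le_nhds) ?_
    filter_upwards [self_mem_nhdsWithin] with t ht h
    exact (ne_of_gt ht) (Complex.ofReal_injective h)
  refine h1.frequently (Filter.Eventually.frequently ?_)
  filter_upwards [Ioo_mem_nhdsGT (show (1 / 2 : ℝ) < 1 by norm_num)] with t ht
  exact h t ⟨by linarith [ht.1], ht.2⟩

/-- Nonzero eigenfunctions only exist for eigenvalues `1 / m` with `m ≤ (2 + α) / p`. -/
lemma eigenvalue_of_ne_zero {p α : ℝ} (hp : 1 < p) (hα : 0 < α) {f : ℂ → ℂ} (hf : f ∈ holo)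
    (hb : ∀ μ, α < μ → bnorm p μ f < ∞) (hf0 : f ≠ 0) {lam : ℂ}
    (h : ∀ z ∈ ball (0 : ℂ) 1, lam * f z - cesaro f z = 0) :
    ∃ m : ℕ, 1 ≤ m ∧ (m : ℝ) ≤ (2 + α) / p ∧ lam = 1 / (m : ℂ) := by
  have hp0 : 0 < p := by linarith
  by_contra hcon
  apply hf0
  by_cases hlam : lam = 0
  · refine holo_ext hf holo.zero_mem fun z hz => ?_
    have h0 : ∀ w ∈ ball (0 : ℂ) 1, cesaro f w = 0 := fun w hw => by
      have := h w hw
      rw [hlam] at this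
      linear_combination -this
    have h1 := cesaro_ode hf.1 hz
    have h2 : deriv (cesaro f) z = 0 := by
      have : cesaro f =ᶠ[𝓝 z] fun _ => 0 := by
        filter_upwards [isOpen_ball.mem_nhds hz] with w hw using h0 w hw
      rw [this.deriv_eq, deriv_const]
    rw [h0 z hz, h2, mul_zero, add_zero, eq_comm,
      div_eq_zero_iff] at h1
    exact h1.resolve_right (one_sub_ne_zero_of_mem_ball hz)
  have hode := fun w hw => resolvent_ode (g := fun _ => 0) hlam hf.1 h (w := w) hw
  set γ := 1 / lam with hγ
  set W : ℝ → ℂ := fun t => (t : ℂ) ^ (1 - γ) * (1 - (t : ℂ)) ^ γ * cesaro f t with hW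
  have hder : ∀ t ∈ Ioo (0 : ℝ) 1, HasDerivAt W 0 t := fun t ht => by
    have := hasDerivAt_integratingFactor (differentiableOn_cesaro hf.1) hode ht
    simpa using this
  have hconst : ∀ t ∈ Ioo (0 : ℝ) 1, W t = W (1 / 2) := fun t ht =>
    isOpen_Ioo.is_const_of_deriv_eq_zero isPreconnected_Ioo
      (fun x hx => (hder x hx).differentiableAt.differentiableWithinAt)
      (fun x hx => (hder x hx).deriv) ht ⟨by norm_num, by norm_num⟩
  -- The constant value of W is read off at one end. If λ = 1/(k+1) with k+1 > (2+α)/p, the growth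
  -- bound makes W tend to 0 at t = 1. If λ is no 1/(k+1), then f vanishes at 0 to any prescribed
  -- order and W tends to 0 at t = 0.
  have hC : W (1 / 2) = 0 := by
    by_cases hex : ∃ k : ℕ, lam = 1 / ((k : ℂ) + 1)
    · obtain ⟨k, hk⟩ := hex
      have hk' : (2 + α) / p < k + 1 := by
        by_contra! hle
        exact hcon ⟨k + 1, by omega, by push_cast; exact hle, by rw [hk]; push_cast; rfl⟩
      have hγk : γ.re = k + 1 := by rw [hγ, hk]; simp
      rw [div_lt_iff₀ hp0] at hk'
      obtain ⟨μ, hμ1, hμ2⟩ := exists_between (show α < (k + 1) * p - 2 by linarith)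
      have h1 := tendsto_radial_growth (s := γ.re) hp (by linarith)
        (by rw [hγk, div_lt_iff₀ hp0]; linarith) hf (hb μ hμ1) (ξ := 1) (by simp)
      have h2 : Filter.Tendsto (fun t : ℝ => (1 - t) ^ γ.re * ‖cesaro f t‖) (𝓝[<] 1) (𝓝 0) := by
        have := h1.const_mul ‖lam‖
        rw [mul_zero] at this
        refine this.congr' ?_
        filter_upwards [Ioo_mem_nhdsLT (zero_lt_one' ℝ)] with t ht
        rw [mul_one, ← sub_eq_zero.1 (h t (ofReal_mem_ball ht)), norm_mul]
        ring
      have h3 := tendsto_integratingFactor_one (γ := γ) rfl h2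
      refine tendsto_nhds_unique (Filter.Tendsto.congr' ?_ tendsto_const_nhds) h3
      filter_upwards [Ioo_mem_nhdsLT (zero_lt_one' ℝ)] with t ht using (hconst t ht).symm
    · push Not at hex
      obtain ⟨m, hm⟩ := exists_nat_gt γ.re
      obtain ⟨k, hk, hfk⟩ := vanishesTo_of_resolvent (N := m) hf.1 (g := fun _ => 0)
        ⟨fun _ => 0, by fun_prop, by simp⟩ h (fun k _ => hex k)
      have h3 := tendsto_integratingFactor_zero (v := cesaro f) (γ := γ) (m := m)
        (k := fun z => lam * k z) (by fun_prop) (fun w hw => by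
          rw [← sub_eq_zero.1 (h w hw), hfk w hw]; ring) (by linarith)
      refine tendsto_nhds_unique (Filter.Tendsto.congr' ?_ tendsto_const_nhds) h3
      filter_upwards [Ioo_mem_nhdsGT (zero_lt_one' ℝ)] with t ht using (hconst t ht).symm
  refine eq_zero_of_eq_zero_on_Ioo hf fun t ht => ?_
  have h1 := hconst t ht
  have ht0 : (t : ℂ) ≠ 0 := by simpa using ht.1.ne'
  have ht1 : 1 - (t : ℂ) ≠ 0 := one_sub_ne_zero_of_mem_ball (ofReal_mem_ball ht)
  rw [hC, hW, mul_eq_zero, mul_eq_zero, Complex.cpow_eq_zero_iff, Complex.cpow_eq_zero_iff] at h1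
  have h2 : cesaro f t = 0 := by tauto
  have h3 := h t (ofReal_mem_ball ht)
  rw [h2, sub_zero, mul_eq_zero] at h3
  exact h3.resolve_left hlam

/-- `lam I - C` has no preimage of some monomial when `(2 + α) / p < Re (1 / lam)`. -/
lemma not_surjective_of_mem_D {p α : ℝ} (hp : 1 < p) (hα : 0 < α) {lam : ℂ}
    (hlam : (2 + α) / p < (1 / lam).re) :
    ∃ N : ℕ, ∀ f ∈ holo, (∀ μ, α < μ → bnorm p μ f < ∞) →
      ¬ ∀ z ∈ ball (0 : ℂ) 1, lam * f z - cesaro f z = monom N z := by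
  have hp0 : 0 < p := by linarith
  have hre : 0 < (1 / lam).re := lt_trans (by positivity) hlam
  have hlam0 : lam ≠ 0 := by rintro rfl; simp at hre
  have hmon : ∀ N : ℕ, VanishesTo N (monom N) := fun N =>
    ⟨fun _ => 1, by fun_prop, fun z hz => by rw [monom_apply N hz, mul_one]⟩
  by_cases hex : ∃ k : ℕ, lam = 1 / ((k : ℂ) + 1)
  · obtain ⟨k, hk⟩ := hex
    -- At λ = 1/(k+1) the obstruction is algebraic: the coefficient of z^k in λ f - C f would be 0,
    -- not 1.
    refine ⟨k, fun f hf _ h => ?_⟩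
    obtain ⟨a, ha, hfa⟩ := vanishesTo_of_resolvent (N := k) hf.1 (hmon k) h (fun j hj he => by
      rw [hk, one_div, one_div, inv_inj, add_left_inj, Nat.cast_inj] at he
      omega)
    have := leading_coeff (b := fun _ => 1) ha (by fun_prop) hfa
      (fun z hz => by rw [monom_apply k hz, mul_one]) h
    rw [hk, sub_self, zero_mul] at this
    exact zero_ne_one this
  · push Not at hex
    -- N > Re γ ensures both that the integrating-factor product vanishes at 0 and that the Beta
    -- integral with parameters N+1-γ and γ converges.
    obtain ⟨N, hN⟩ := exists_nat_gt (1 / lam).re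
    refine ⟨N, fun f hf hb h => ?_⟩
    have hode := fun w hw => resolvent_ode hlam0 hf.1 h (w := w) hw
    set γ := 1 / lam
    obtain ⟨a, ha, hfa⟩ := vanishesTo_of_resolvent (N := N) hf.1 (hmon N) h (fun k _ => hex k)
    have hces : ∀ z ∈ ball (0 : ℂ) 1, cesaro f z = lam * f z - z ^ N := fun z hz => by
      rw [← monom_apply N hz, ← h z hz]; ring
    rw [div_lt_iff₀ hp0] at hlam
    obtain ⟨μ, hμ1, hμ2⟩ := exists_between (show α < γ.re * p - 2 by linarith)
    have hs : (2 + μ) / p < γ.re := by rw [div_lt_iff₀ hp0]; linarith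
    have h1 : Filter.Tendsto (fun t : ℝ => (1 - t) ^ γ.re * ‖cesaro f t‖) (𝓝[<] 1) (𝓝 0) := by
      have g1 := tendsto_radial_growth hp (by linarith) hs (cesaroExt_mem_holo hf) (by
        have e : cesaroExt f = lam • f - monom N := by
          refine holo_ext (cesaroExt_mem_holo hf)
            (holo.sub_mem (holo.smul_mem _ hf) (monom_mem_holo N)) fun z hz => ?_
          rw [cesaroExt_apply _ hz, Pi.sub_apply, ← h z hz]
          simp
        rw [e]
        refine (bnorm_sub_le hp (holo.smul_mem _ hf) (monom_mem_holo N)).trans_lt ?_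
        rw [bnorm_smul]
        exact ENNReal.add_lt_top.2 ⟨ENNReal.mul_lt_top enorm_lt_top (hb μ hμ1),
          bnorm_monom_lt_top (by linarith) N⟩) (ξ := 1) (by simp)
      refine g1.congr' ?_
      filter_upwards [Ioo_mem_nhdsLT (zero_lt_one' ℝ)] with t ht
      rw [mul_one, cesaroExt_apply _ (ofReal_mem_ball ht)]
    have hbeta := Complex.betaIntegral_convergent (u := (N : ℂ) + 1 - γ) (v := γ)
      (by simp; linarith) hre
    have heq : ∀ t ∈ Ioo (0 : ℝ) 1,
        γ * ((t : ℂ) ^ ((N : ℂ) + 1 - γ - 1) * (1 - (t : ℂ)) ^ (γ - 1)) =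
        γ * ((t : ℂ) ^ (-γ) * (1 - (t : ℂ)) ^ (γ - 1) * monom N t) := fun t ht => by
      have ht0 : (t : ℂ) ≠ 0 := by simpa using ht.1.ne'
      rw [monom_apply N (ofReal_mem_ball ht), show (N : ℂ) + 1 - γ - 1 = N + -γ by ring,
        Complex.cpow_add _ _ ht0, Complex.cpow_natCast]
      ring
    -- Both boundary values are 0, so γ B(N+1-γ, γ) = 0. But B(a,b) Γ(a+b) = Γ(a) Γ(b), and Γ has no
    -- zeros in the right half-plane.
    have hFTC := intervalIntegral.integral_eq_sub_of_hasDerivAt_of_tendsto zero_lt_one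
      (f' := fun t : ℝ => γ * ((t : ℂ) ^ ((N : ℂ) + 1 - γ - 1) * (1 - (t : ℂ)) ^ (γ - 1)))
      (fun t ht => (hasDerivAt_integratingFactor (differentiableOn_cesaro hf.1) hode ht).congr_deriv
        (heq t ht).symm)
      (hbeta.const_mul γ)
      (tendsto_integratingFactor_zero (k := fun z => lam * a z - 1) (m := N) (by fun_prop)
        (fun w hw => by rw [hces w hw, hfa w hw]; ring) (by linarith))
      (tendsto_integratingFactor_one rfl h1)
    rw [intervalIntegral.integral_const_mul, sub_zero, mul_eq_zero] at hFTC
    have hγ0 : γ ≠ 0 := one_div_ne_zero hlam0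
    have hB := hFTC.resolve_left hγ0
    have hG := Complex.Gamma_mul_Gamma_eq_betaIntegral (s := (N : ℂ) + 1 - γ) (t := γ)
      (by simp; linarith) hre
    rw [Complex.betaIntegral, hB, mul_zero, mul_eq_zero] at hG
    rcases hG with hG | hG
    · exact Complex.Gamma_ne_zero_of_re_pos (by simp; linarith) hG
    · exact Complex.Gamma_ne_zero_of_re_pos hre hG

/-! ### Eigenfunctions. -/

/-- The eigenfunction `z ^ k (1 - z) ^ (-(k + 1))`. -/
noncomputable def eigenfun (k : ℕ) : ℂ → ℂ :=
  (ball (0 : ℂ) 1).indicator fun z => z ^ k / (1 - z) ^ (k + 1)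

lemma differentiableOn_eigenfun (k : ℕ) :
    DifferentiableOn ℂ (fun z : ℂ => z ^ k / (1 - z) ^ (k + 1)) (ball 0 1) :=
  DifferentiableOn.div (by fun_prop) (by fun_prop)
    fun _ hz => pow_ne_zero _ (one_sub_ne_zero_of_mem_ball hz)

lemma eigenfun_mem_holo (k : ℕ) : eigenfun k ∈ holo :=
  indicator_mem_holo (differentiableOn_eigenfun k)

lemma eigenfun_apply (k : ℕ) {z : ℂ} (hz : z ∈ ball (0 : ℂ) 1) :
    eigenfun k z = z ^ k / (1 - z) ^ (k + 1) := indicator_of_mem hz _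

lemma bnorm_eigenfun_lt_top {p μ : ℝ} (hp : 1 < p) (hμ : 0 ≤ μ) {k : ℕ}
    (hk : (k + 1) * p < 2 + μ) : bnorm p μ (eigenfun k) < ∞ := by
  refine bnorm_lt_top_of_le_rpow (b := k + 1) hp hμ hk (ξ := 1) (by simp) fun z hz => ?_
  rw [eigenfun_apply k hz, norm_div, norm_pow, norm_pow, Real.rpow_neg (norm_nonneg _), div_eq_mul_inv]
  have : ‖1 - z‖ ^ ((k : ℝ) + 1) = ‖1 - z‖ ^ (k + 1) := by
    rw [← Nat.cast_add_one, Real.rpow_natCast]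
  rw [this]
  exact mul_le_of_le_one_left (by positivity)
    (pow_le_one₀ (norm_nonneg _) (mem_ball_zero_iff.1 hz).le)

/-- This is the homogeneous solution z^(γ-1) (1-z)^(-γ) with γ = k+1, recognised through uniqueness
for the differential equation. -/
lemma cesaro_eigenfun (k : ℕ) {z : ℂ} (hz : z ∈ ball (0 : ℂ) 1) :
    cesaro (eigenfun k) z = 1 / ((k : ℂ) + 1) * eigenfun k z := by
  have hk : (k : ℂ) + 1 ≠ 0 := Nat.cast_add_one_ne_zero k
  rw [eigenfun_apply k hz]
  refine eq_cesaro_of_ode (F := fun z => 1 / ((k : ℂ) + 1) * (z ^ k / (1 - z) ^ (k + 1)))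
    ((differentiableOn_eigenfun k).const_mul _) (fun w hw => ?_) hz
  have hne := one_sub_ne_zero_of_mem_ball hw
  have h1 : HasDerivAt (fun z : ℂ => (1 - z) ^ (k + 1)) (((k + 1 : ℕ) : ℂ) * (1 - w) ^ k * -1) w := by
    have := ((hasDerivAt_id w).const_sub 1).fun_pow (k + 1)
    simpa using this
  have h2 := (((hasDerivAt_pow k w).div h1 (pow_ne_zero _ hne)).const_mul (1 / ((k : ℂ) + 1))).deriv
  have h2' : deriv (fun z => 1 / ((k : ℂ) + 1) * (z ^ k / (1 - z) ^ (k + 1))) w = _ := h2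
  have e3 : w * ((k : ℂ) * w ^ (k - 1)) = k * w ^ k := by
    rcases k with _ | k
    · simp
    · simp [pow_succ]; ring
  rw [h2', eigenfun_apply k hw]
  push_cast
  have e4 : w * (1 / ((k : ℂ) + 1) * (((k : ℂ) * w ^ (k - 1) * (1 - w) ^ (k + 1) -
      w ^ k * (((k : ℂ) + 1) * (1 - w) ^ k * -1)) / ((1 - w) ^ (k + 1)) ^ 2)) =
      1 / ((k : ℂ) + 1) * (((k : ℂ) * w ^ k * (1 - w) ^ (k + 1) +
      w * w ^ k * (((k : ℂ) + 1) * (1 - w) ^ k)) / ((1 - w) ^ (k + 1)) ^ 2) := by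
    rw [← e3]; ring
  rw [e4]
  field_simp
  ring

/-! ### Non-surjectivity at λ = 0. -/

/-- The Cesàro operator is not surjective: `(1 + z) ^ (-r)`, `r = (2 + α) / p`, is not in its
range. -/
lemma not_mem_range_cesaro {p α : ℝ} (hp : 1 < p) (hα : 0 < α) :
    ∃ g ∈ holo, (∀ μ, α < μ → bnorm p μ g < ∞) ∧ ∀ f ∈ holo,
      (∀ μ, α < μ → bnorm p μ f < ∞) → ¬ ∀ z ∈ ball (0 : ℂ) 1, cesaro f z = g z := by
  have hp0 : 0 < p := by linarith
  set r := (2 + α) / p with hr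
  have hr0 : 0 < r := by positivity
  have hsl : ∀ z ∈ ball (0 : ℂ) 1, 1 + z ∈ Complex.slitPlane := fun z hz => by
    have h1 := Complex.abs_re_le_norm z
    have h2 := mem_ball_zero_iff.1 hz
    have h3 := neg_abs_le z.re
    exact Or.inl (by simp; linarith)
  have hd : DifferentiableOn ℂ (fun z : ℂ => (1 + z) ^ (-(r : ℂ))) (ball 0 1) := fun z hz =>
    ((differentiableAt_id.const_add 1).cpow_const (hsl z hz)).differentiableWithinAt
  refine ⟨_, indicator_mem_holo hd, fun μ hμ => ?_, fun f hf hb h => ?_⟩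
  · refine bnorm_lt_top_of_le_rpow (b := r) hp (by linarith) ?_ (ξ := -1) (by simp) fun z hz => ?_
    · rw [hr, div_mul_cancel₀ _ hp0.ne']; linarith
    · rw [indicator_of_mem hz, show -(r : ℂ) = ((-r : ℝ) : ℂ) by push_cast; rfl,
        Complex.norm_cpow_real, ← norm_neg (1 + z), neg_add, ← sub_eq_add_neg]
  · have hs : (2 + (α + 1)) / p < r + 1 := by
      rw [hr, div_add_one hp0.ne']
      exact div_lt_div_of_pos_right (by linarith) hp0
    have h1 := tendsto_radial_growth hp (by linarith) hs hf (hb (α + 1) (by linarith)) (ξ := -1)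
      (by simp)
    have h2 : Filter.Tendsto (fun t : ℝ => r * t) (𝓝[<] 1) (𝓝 r) := by
      have : ContinuousAt (fun t : ℝ => r * t) 1 := by fun_prop
      have := this.tendsto
      rw [mul_one] at this
      exact this.mono_left nhdsWithin_le_nhds
    -- The contradiction is rt ≤ (1-t)^(r+1) |f(-t)| as t → 1: the left side tends to r > 0, the
    -- right side to 0.
    refine absurd (le_of_tendsto_of_tendsto h2 h1 ?_) (not_le.2 hr0)
    filter_upwards [Ioo_mem_nhdsLT (zero_lt_one' ℝ)] with t ht
    have hz : ((-t : ℝ) : ℂ) ∈ ball (0 : ℂ) 1 := by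
      rw [mem_ball_zero_iff, Complex.norm_real, norm_neg, Real.norm_of_nonneg ht.1.le]
      exact ht.2
    have ht1 : 0 < 1 - t := by linarith [ht.2]
    have hev : cesaro f =ᶠ[𝓝 ((-t : ℝ) : ℂ)] fun z : ℂ => (1 + z) ^ (-(r : ℂ)) := by
      filter_upwards [isOpen_ball.mem_nhds hz] with w hw
      rw [h w hw, indicator_of_mem hw]
    have hode := cesaro_ode hf.1 hz
    have hder := ((hasDerivAt_id ((-t : ℝ) : ℂ)).const_add 1).cpow_const (c := -(r : ℂ)) (hsl _ hz)
    have hder' : deriv (fun z : ℂ => (1 + z) ^ (-(r : ℂ))) ((-t : ℝ) : ℂ) = _ := hder.deriv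
    rw [hev.deriv_eq, hev.eq_of_nhds, hder'] at hode
    have e1 : (1 + ((-t : ℝ) : ℂ)) = ((1 - t : ℝ) : ℂ) := by push_cast; ring
    have e2 : (1 - ((-t : ℝ) : ℂ)) = ((1 + t : ℝ) : ℂ) := by push_cast; ring
    have e3 : -(r : ℂ) = ((-r : ℝ) : ℂ) := by push_cast; rfl
    simp only [id, mul_one] at hode
    rw [e1, e2, e3, show ((-r : ℝ) : ℂ) - 1 = ((-r - 1 : ℝ) : ℂ) by push_cast; rfl,
      ← Complex.ofReal_cpow ht1.le, ← Complex.ofReal_cpow ht1.le,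
      eq_div_iff (by exact_mod_cast (by linarith [ht.1] : (1 + t) ≠ 0))] at hode
    have e4 : f ((t : ℂ) * -1) =
        ((((1 - t) ^ (-r) + r * t * (1 - t) ^ (-r - 1)) * (1 + t) : ℝ) : ℂ) := by
      rw [show (t : ℂ) * -1 = ((-t : ℝ) : ℂ) by push_cast; ring, ← hode]
      push_cast
      ring
    have hA : 0 < (1 - t) ^ (-r) := Real.rpow_pos_of_pos ht1 _
    have hB : 0 < (1 - t) ^ (-r - 1) := Real.rpow_pos_of_pos ht1 _
    have ht0 := ht.1
    rw [e4, Complex.norm_of_nonneg (by positivity)]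
    calc r * t = (1 - t) ^ (r + 1) * ((r * t * (1 - t) ^ (-r - 1)) * 1) := by
          rw [mul_one, mul_left_comm, ← Real.rpow_add ht1]
          simp
      _ ≤ _ := by
          have : 0 ≤ (1 - t) ^ (r + 1) := by positivity
          gcongr
          · linarith
          · linarith

/-! ### The operator on the Fréchet space. -/

namespace BergmanPlus

variable {p α : ℝ}

lemma mem_holo (f : BergmanPlus p α) : (f : ℂ → ℂ) ∈ holo :=
  (mem_bergman f (lt_add_one α)).1

lemma bnorm_lt_top (f : BergmanPlus p α) {μ : ℝ} (h : α < μ) : bnorm p μ f < ∞ :=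
  (mem_bergman f h).2.2

lemma lt_exponent (α : ℝ) (n : ℕ) : α < α + 1 / ((n : ℝ) + 1) :=
  lt_add_of_pos_right α (by positivity)

lemma exponent_le (α : ℝ) (n : ℕ) : α + 1 / ((n : ℝ) + 1) ≤ α + 1 := by
  have : 1 / ((n : ℝ) + 1) ≤ 1 := by
    rw [div_le_one (by positivity)]
    linarith [(Nat.cast_nonneg n : (0 : ℝ) ≤ n)]
  linarith

lemma ext_ball {f g : BergmanPlus p α} (h : ∀ z ∈ ball (0 : ℂ) 1, f z = g z) : f = g :=
  Subtype.ext (holo_ext f.mem_holo g.mem_holo h)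

variable [hp : Fact (1 < p)]

lemma norms_apply (n : ℕ) (f : BergmanPlus p α) :
    norms p α n f = (bnorm p (α + 1 / ((n : ℝ) + 1)) f).toReal := rfl

lemma norms_comp_le {T : BergmanPlus p α →ₗ[ℂ] BergmanPlus p α} {n : ℕ} {M : ℝ≥0∞} (hM : M ≠ ∞)
    (h : ∀ f, bnorm p (α + 1 / ((n : ℝ) + 1)) (T f) ≤ M * bnorm p (α + 1 / ((n : ℝ) + 1)) f) :
    (norms p α n).comp T ≤ M.toNNReal • norms p α n := by
  intro f
  change norms p α n (T f) ≤ M.toReal * norms p α n f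
  rw [norms_apply, norms_apply, ← ENNReal.toReal_mul]
  exact ENNReal.toReal_mono (ENNReal.mul_ne_top hM (f.bnorm_lt_top (lt_exponent α n)).ne) (h f)

lemma continuous_of_bnorm_le (T : BergmanPlus p α →ₗ[ℂ] BergmanPlus p α)
    (h : ∀ n : ℕ, ∃ M : ℝ≥0∞, M ≠ ∞ ∧ ∀ f : BergmanPlus p α,
      bnorm p (α + 1 / ((n : ℝ) + 1)) (T f) ≤ M * bnorm p (α + 1 / ((n : ℝ) + 1)) f) :
    Continuous T := by
  refine withSeminorms_norms.continuous_of_isBounded withSeminorms_norms T fun n => ?_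
  obtain ⟨M, hM, hT⟩ := h n
  refine ⟨{n}, M.toNNReal, ?_⟩
  rw [Finset.sup_singleton]
  exact norms_comp_le hM hT

end BergmanPlus

open BergmanPlus

variable {p α : ℝ} [hp : Fact (1 < p)]

lemma cesaroExt_mem_bergmanPlus (hα : 0 < α) (f : BergmanPlus p α) :
    cesaroExt f ∈ bergmanPlus p α := by
  refine mem_bergmanPlus (cesaroExt_mem_holo f.mem_holo) fun n => ?_
  have hn := lt_exponent α n
  obtain ⟨M, hM, h⟩ := bnorm_cesaroExt_le hp.out (hα.trans hn)
  exact (h f f.mem_holo).trans_lt (ENNReal.mul_lt_top hM.lt_top (f.bnorm_lt_top hn))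

/-- The Cesàro operator on `A^p_{α+}`. -/
noncomputable def cesaroCLM (p : ℝ) [hp : Fact (1 < p)] {α : ℝ} (hα : 0 < α) :
    BergmanPlus p α →L[ℂ] BergmanPlus p α where
  toFun f := ⟨cesaroExt f, cesaroExt_mem_bergmanPlus hα f⟩
  map_add' f g := Subtype.ext (cesaroExt_add f.mem_holo g.mem_holo)
  map_smul' c f := Subtype.ext (cesaroExt_smul f.mem_holo c)
  cont := continuous_of_bnorm_le
    { toFun := fun f => ⟨cesaroExt f, cesaroExt_mem_bergmanPlus hα f⟩
      map_add' := fun f g => Subtype.ext (cesaroExt_add f.mem_holo g.mem_holo)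
      map_smul' := fun c f => Subtype.ext (cesaroExt_smul f.mem_holo c) }
    fun n => by
      obtain ⟨M, hM, h⟩ := bnorm_cesaroExt_le hp.out (hα.trans (lt_exponent α n))
      exact ⟨M, hM, fun f => h f f.mem_holo⟩

lemma cesaroCLM_apply (hα : 0 < α) (f : BergmanPlus p α) {z : ℂ} (hz : z ∈ ball (0 : ℂ) 1) :
    cesaroCLM p hα f z = cesaro f z := cesaroExt_apply f hz

lemma algebraMap_sub_apply (hα : 0 < α) (lam : ℂ) (f : BergmanPlus p α) :
    (algebraMap ℂ (BergmanPlus p α →L[ℂ] BergmanPlus p α) lam - cesaroCLM p hα) f =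
      lam • f - cesaroCLM p hα f := by
  rw [Algebra.algebraMap_eq_smul_one]
  rfl

lemma smul_sub_cesaroCLM_apply (hα : 0 < α) (lam : ℂ) (f : BergmanPlus p α) {z : ℂ}
    (hz : z ∈ ball (0 : ℂ) 1) :
    (lam • f - cesaroCLM p hα f : BergmanPlus p α) z = lam * f z - cesaro f z := by
  rw [← cesaroCLM_apply hα f hz]
  rfl

/-! ### The point spectrum. -/

lemma pointSpectrum_subset (hα : 0 < α) : pointSpectrum (cesaroCLM p hα) ⊆
    {lam : ℂ | ∃ m : ℕ, 1 ≤ m ∧ (m : ℝ) ≤ (2 + α) / p ∧ lam = 1 / (m : ℂ)} := by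
  intro lam hlam
  rw [pointSpectrum, mem_ofPred_eq, Function.Injective] at hlam
  push Not at hlam
  obtain ⟨f, g, hfg, hne⟩ := hlam
  refine eigenvalue_of_ne_zero hp.out hα (f - g).mem_holo
    (fun μ hμ => (f - g).bnorm_lt_top hμ) (fun h => hne (sub_eq_zero.1 (Subtype.ext h)))
    fun z hz => ?_
  rw [← smul_sub_cesaroCLM_apply hα lam (f - g) hz]
  have : lam • (f - g) - cesaroCLM p hα (f - g) = 0 := by
    rw [smul_sub, map_sub, sub_sub_sub_comm]
    exact sub_eq_zero.2 hfg
  rw [this]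
  rfl

/-- The endpoint m = (2+α)/p is included: membership in A^p_μ needs mp < 2 + μ only for μ > α. The
endpoint is needed to place every 1/m in the spectrum. -/
lemma subset_pointSpectrum (hα : 0 < α) :
    {lam : ℂ | ∃ m : ℕ, 1 ≤ m ∧ (m : ℝ) ≤ (2 + α) / p ∧ lam = 1 / (m : ℂ)} ⊆
      pointSpectrum (cesaroCLM p hα) := by
  rintro _ ⟨m, hm1, hm, rfl⟩ hinj
  obtain ⟨k, rfl⟩ : ∃ k, m = k + 1 := ⟨m - 1, by omega⟩
  have hp0 : 0 < p := by linarith [hp.out]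
  rw [le_div_iff₀ hp0] at hm
  push_cast at hm
  let e : BergmanPlus p α := ⟨eigenfun k, mem_bergmanPlus (eigenfun_mem_holo k) fun n =>
    bnorm_eigenfun_lt_top hp.out (hα.trans (lt_exponent α n)).le (by
      have := lt_exponent α n
      linarith)⟩
  have he : e = 0 := by
    apply hinj
    refine ext_ball fun z hz => ?_
    rw [smul_sub_cesaroCLM_apply hα _ e hz, smul_sub_cesaroCLM_apply hα _ 0 hz,
      show (e : ℂ → ℂ) = eigenfun k from rfl, cesaro_eigenfun k hz]
    have h0 : cesaro ((0 : BergmanPlus p α) : ℂ → ℂ) z = 0 := by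
      rw [← cesaroCLM_apply hα _ hz, map_zero]
      rfl
    rw [h0, show ((0 : BergmanPlus p α) : ℂ → ℂ) z = 0 from rfl]
    push_cast
    ring
  have h1 : eigenfun k ((1 / 2 : ℝ) : ℂ) = 0 := congrFun (congrArg Subtype.val he) _
  rw [eigenfun_apply k (ofReal_mem_ball ⟨by norm_num, by norm_num⟩), div_eq_zero_iff] at h1
  rcases h1 with h1 | h1 <;> replace h1 := eq_zero_of_pow_eq_zero h1 <;> norm_num at h1

/-! ### The spectrum and the Waelbroeck spectrum. -/

/-- Inversion maps the circle through 0 and 1/r with this diameter to the line Re = r. -/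
lemma mem_D_iff {r : ℝ} (hr : 0 < r) {lam : ℂ} (hlam : lam ≠ 0) :
    lam ∈ D r ↔ r < (1 / lam).re := by
  have hn : 0 < Complex.normSq lam := Complex.normSq_pos.2 hlam
  have hc : 0 < 1 / (2 * r) := by positivity
  rw [D, mem_ofPred_eq, ← sq_lt_sq₀ (norm_nonneg _) hc.le, ← Complex.normSq_eq_norm_sq, one_div lam,
    Complex.inv_re, lt_div_iff₀ hn, Complex.normSq_apply] at *
  simp only [Complex.sub_re, Complex.sub_im, Complex.ofReal_re, Complex.ofReal_im]
  have e : r * (1 / (2 * r)) = 1 / 2 := by field_simp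
  set c := 1 / (2 * r)
  constructor
  · intro h
    have h2 : lam.re * lam.re + lam.im * lam.im < 2 * c * lam.re := by nlinarith
    have h3 := mul_lt_mul_of_pos_left h2 hr
    have h4 : r * (2 * c * lam.re) = lam.re := by linear_combination 2 * lam.re * e
    rw [Complex.normSq_apply]
    linarith
  · intro h
    rw [Complex.normSq_apply] at h
    have h4 : r * (2 * c * lam.re) = lam.re := by linear_combination 2 * lam.re * e
    have h2 : lam.re * lam.re + lam.im * lam.im < 2 * c * lam.re := by
      refine lt_of_mul_lt_mul_left ?_ hr.le
      linarith
    nlinarith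

lemma bijective_of_mem_resolventSet (hα : 0 < α) {lam : ℂ}
    (h : lam ∈ resolventSet ℂ (cesaroCLM p hα)) :
    Function.Bijective fun f : BergmanPlus p α => lam • f - cesaroCLM p hα f := by
  obtain ⟨u, hu⟩ := h
  have h1 : ∀ f, (u : BergmanPlus p α →L[ℂ] BergmanPlus p α) f = lam • f - cesaroCLM p hα f :=
    fun f => by rw [hu]; exact algebraMap_sub_apply hα lam f
  constructor
  · intro f g hfg
    simp only [← h1] at hfg
    have h2 := congrArg (fun x => (↑u⁻¹ : BergmanPlus p α →L[ℂ] BergmanPlus p α) x) hfg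
    simpa only [← mul_apply_eq_comp, Units.inv_mul, one_apply_eq_self]
      using h2
  · intro g
    refine ⟨(↑u⁻¹ : BergmanPlus p α →L[ℂ] BergmanPlus p α) g, ?_⟩
    simp only [← h1]
    rw [← mul_apply_eq_comp, Units.mul_inv, one_apply_eq_self]

lemma subset_spectrum (hα : 0 < α) :
    {0} ∪ D ((2 + α) / p) ∪ pointSpectrum (cesaroCLM p hα) ⊆ spectrum ℂ (cesaroCLM p hα) := by
  have hp0 : 0 < p := by linarith [hp.out]
  intro lam hlam hres
  have hbij := bijective_of_mem_resolventSet hα hres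
  by_cases h0 : lam = 0
  · subst h0
    obtain ⟨g, hg, hgb, hne⟩ := not_mem_range_cesaro hp.out hα
    obtain ⟨f, hf⟩ := hbij.2 ⟨g, mem_bergmanPlus hg fun n => hgb _ (lt_exponent α n)⟩
    -- At λ = 0 the operator is -C, so the Cesàro preimage of g is -f.
    refine hne _ (-f).mem_holo (fun μ hμ => (-f).bnorm_lt_top hμ) fun z hz => ?_
    have h1 : cesaroCLM p hα (-f) = ⟨g, mem_bergmanPlus hg fun n => hgb _ (lt_exponent α n)⟩ := by
      refine Eq.trans ?_ hf
      simp only [map_neg, zero_smul, zero_sub]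
    rw [← cesaroCLM_apply hα _ hz, h1]
  · rcases hlam with (hlam | hlam) | hlam
    · exact h0 hlam
    · rw [mem_D_iff (by positivity) h0] at hlam
      obtain ⟨N, hN⟩ := not_surjective_of_mem_D hp.out hα hlam
      obtain ⟨f, hf⟩ := hbij.2 ⟨monom N, mem_bergmanPlus (monom_mem_holo N) fun n =>
        bnorm_monom_lt_top (hα.trans (lt_exponent α n)).le N⟩
      refine hN f f.mem_holo (fun μ hμ => f.bnorm_lt_top hμ) fun z hz => ?_
      rw [← smul_sub_cesaroCLM_apply hα lam f hz]
      exact congrFun (congrArg Subtype.val hf) z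
    · exact hlam hbij.1

/-- Resolvents of the Cesàro operator exist, with uniform bounds, away from the exceptional
points and from the disc `D_r`. -/
lemma exists_uniform_resolvent_bound (hα : 0 < α) {δ : ℝ} (hδ : 0 < δ) (R : ℝ) :
    ∃ M : ℕ → ℝ≥0∞, (∀ n, M n ≠ ∞) ∧ ∀ lam : ℂ, δ ≤ ‖lam‖ → ‖lam‖ ≤ R →
      (1 / lam).re ≤ (2 + α) / p →
      (∀ k ∈ {ν : ℂ | ∃ i : ℕ, ν = 1 / ((i : ℂ) + 1)}, δ ≤ ‖lam - k‖) →
      lam ∈ resolventSet ℂ (cesaroCLM p hα) ∧ ∀ (n : ℕ) (g : BergmanPlus p α),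
        bnorm p (α + 1 / ((n : ℝ) + 1)) (resolvent (cesaroCLM p hα) lam g) ≤
          M n * bnorm p (α + 1 / ((n : ℝ) + 1)) g := by
  have hp0 : 0 < p := by linarith [hp.out]
  obtain ⟨m, hm1, hrm, hm⟩ := exists_order (μ := α + 1) hp.out ((2 + α) / p)
  -- Order of vanishing k = 0, reached after j = m reductions, imposes no condition on g.
  obtain ⟨M, hM, h⟩ := exists_resolvent_bound hp.out hα (div_mul_cancel₀ _ hp0.ne').le hm1 hrm hm
    hδ R m 0 (zero_add m)
  refine ⟨fun n => M (α + 1 / ((n : ℝ) + 1)), fun n => hM _, fun lam h1 h2 h3 h4 => ?_⟩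
  have hsol : ∀ g : BergmanPlus p α, ∃ F : BergmanPlus p α, lam • F - cesaroCLM p hα F = g ∧
      ∀ n : ℕ, bnorm p (α + 1 / ((n : ℝ) + 1)) F ≤
        M (α + 1 / ((n : ℝ) + 1)) * bnorm p (α + 1 / ((n : ℝ) + 1)) g := by
    intro g
    obtain ⟨F, hF, hFe, hFb⟩ := h lam h1 h2 h3 (fun i _ => h4 _ ⟨i, rfl⟩) g g.mem_holo
      ⟨g, g.mem_holo.1, by simp⟩
    have hb := fun n : ℕ => hFb _ (lt_exponent α n) (exponent_le α n)
    let F' : BergmanPlus p α := ⟨F, mem_bergmanPlus hF fun n => (hb n).trans_lt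
      (ENNReal.mul_lt_top (hM _).lt_top (g.bnorm_lt_top (lt_exponent α n)))⟩
    exact ⟨F', ext_ball fun z hz =>
      (smul_sub_cesaroCLM_apply hα lam F' hz).trans (hFe z hz), hb⟩
  have hinj : Function.Injective fun f : BergmanPlus p α => lam • f - cesaroCLM p hα f := by
    by_contra hcon
    obtain ⟨k, hk1, hk2, rfl⟩ := pointSpectrum_subset hα (show lam ∈ pointSpectrum _ from hcon)
    have := h4 (1 / (k : ℂ)) ⟨k - 1, by
      rw [Nat.cast_sub hk1]
      simp⟩
    rw [sub_self, norm_zero] at this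
    linarith
  set T := algebraMap ℂ (BergmanPlus p α →L[ℂ] BergmanPlus p α) lam - cesaroCLM p hα with hT
  have hTa : ∀ f, T f = lam • f - cesaroCLM p hα f := fun f => algebraMap_sub_apply hα lam f
  have hTbij : Function.Bijective (T : BergmanPlus p α →ₗ[ℂ] BergmanPlus p α) := by
    constructor
    · intro f g hfg
      exact hinj ((hTa f).symm.trans (hfg.trans (hTa g)))
    · intro g
      obtain ⟨F, hF, -⟩ := hsol g
      exact ⟨F, (hTa F).trans hF⟩
  let E := LinearEquiv.ofBijective (T : BergmanPlus p α →ₗ[ℂ] BergmanPlus p α) hTbij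
  have hEs : ∀ g, T (E.symm g) = g := fun g => E.apply_symm_apply g
  have hsE : ∀ g, E.symm (T g) = g := fun g => E.symm_apply_apply g
  have hbound : ∀ (n : ℕ) (g : BergmanPlus p α), bnorm p (α + 1 / ((n : ℝ) + 1)) (E.symm g) ≤
      M (α + 1 / ((n : ℝ) + 1)) * bnorm p (α + 1 / ((n : ℝ) + 1)) g := by
    intro n g
    obtain ⟨F, hF, hFb⟩ := hsol g
    have : E.symm g = F := by rw [← hF, ← hTa, hsE]
    rw [this]
    exact hFb n
  -- The inverse is continuous by the a priori bounds themselves, each norm being controlled by the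
  -- same norm; no open mapping theorem is involved.
  let S : BergmanPlus p α →L[ℂ] BergmanPlus p α :=
    ⟨(E.symm : BergmanPlus p α →ₗ[ℂ] BergmanPlus p α),
      continuous_of_bnorm_le _ fun n => ⟨_, hM _, hbound n⟩⟩
  let u : (BergmanPlus p α →L[ℂ] BergmanPlus p α)ˣ :=
    ⟨T, S, ContinuousLinearMap.ext hEs, ContinuousLinearMap.ext hsE⟩
  have hres : resolvent (cesaroCLM p hα) lam = S := by
    rw [resolvent, ← hT]
    exact Ring.inverse_unit u
  exact ⟨⟨u, rfl⟩, fun n g => by rw [hres]; exact hbound n g⟩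

/-- A convergent sequence with its limit is compact. Closedness gives each point outside a positive
distance δ from all exceptional points at once, as the uniform bound requires. -/
lemma isClosed_exceptional : IsClosed ({0} ∪ {ν : ℂ | ∃ i : ℕ, ν = 1 / ((i : ℂ) + 1)}) := by
  have h1 : Filter.Tendsto (fun i : ℕ => 1 / ((i : ℂ) + 1)) Filter.atTop (𝓝 0) :=
    tendsto_one_div_add_atTop_nhds_zero_nat
  have := h1.isCompact_insert_range.isClosed
  convert this using 1
  ext ν
  simp [eq_comm]

/-- Each 1/m lies in D_r when m > r = (2+α)/p and is an eigenvalue when m ≤ r. Hence a point off the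
spectrum, or off its closure, stays away from the exceptional set. -/
lemma exceptional_subset_spectrum (hα : 0 < α) :
    {0} ∪ {ν : ℂ | ∃ i : ℕ, ν = 1 / ((i : ℂ) + 1)} ⊆
      {0} ∪ D ((2 + α) / p) ∪ pointSpectrum (cesaroCLM p hα) := by
  have hp0 : 0 < p := by linarith [hp.out]
  rintro ν (hν | ⟨i, rfl⟩)
  · exact Or.inl (Or.inl hν)
  · have hne : (i : ℂ) + 1 ≠ 0 := Nat.cast_add_one_ne_zero i
    by_cases hi : (2 + α) / p < i + 1
    · refine Or.inl (Or.inr ((mem_D_iff (by positivity) (one_div_ne_zero hne)).2 ?_))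
      rw [one_div_one_div]
      simpa using hi
    · refine Or.inr (subset_pointSpectrum hα ⟨i + 1, by omega, ?_, by push_cast; rfl⟩)
      push_cast
      linarith

/-- The set s is a singleton for the spectrum, since a point on the boundary circle of D_r has no
neighbourhood disjoint from D_r, and a full ball for the Waelbroeck spectrum. -/
lemma uniform_resolvent_on_ball (hα : 0 < α) {lam : ℂ} {δ : ℝ} (hδ : 0 < δ) {s : Set ℂ}
    (hs : s ⊆ ball lam δ)
    (h1 : ∀ k ∈ {0} ∪ {ν : ℂ | ∃ i : ℕ, ν = 1 / ((i : ℂ) + 1)}, 2 * δ ≤ dist lam k)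
    (h2 : ∀ ν ∈ s, ν ∉ D ((2 + α) / p)) :
    ∃ M : ℕ → ℝ≥0∞, (∀ n, M n ≠ ∞) ∧ ∀ ν ∈ s,
      ν ∈ resolventSet ℂ (cesaroCLM p hα) ∧ ∀ (n : ℕ) (g : BergmanPlus p α),
        bnorm p (α + 1 / ((n : ℝ) + 1)) (resolvent (cesaroCLM p hα) ν g) ≤
          M n * bnorm p (α + 1 / ((n : ℝ) + 1)) g := by
  have hp0 : 0 < p := by linarith [hp.out]
  obtain ⟨M, hM, h⟩ := exists_uniform_resolvent_bound (p := p) hα hδ (‖lam‖ + δ)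
  have hdist : ∀ ν ∈ s, ∀ k ∈ {0} ∪ {ν : ℂ | ∃ i : ℕ, ν = 1 / ((i : ℂ) + 1)}, δ ≤ ‖ν - k‖ := by
    intro ν hν k hk
    have e1 := h1 k hk
    have e2 := mem_ball.1 (hs hν)
    have e3 := dist_triangle_left lam k ν
    rw [← dist_eq_norm]
    linarith
  refine ⟨M, hM, fun ν hν => ?_⟩
  have hν0 : δ ≤ ‖ν‖ := by simpa using hdist ν hν 0 (Or.inl rfl)
  refine h ν hν0 ?_ ?_ fun k hk => hdist ν hν k (Or.inr hk)
  · have e2 := mem_ball_iff_norm.1 (hs hν)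
    have := norm_sub_norm_le ν lam
    linarith
  · rw [← not_lt, ← mem_D_iff (by positivity) (norm_pos_iff.1 (hδ.trans_le hν0))]
    exact h2 ν hν

lemma spectrum_cesaroCLM (hα : 0 < α) : spectrum ℂ (cesaroCLM p hα) =
    {0} ∪ D ((2 + α) / p) ∪ pointSpectrum (cesaroCLM p hα) := by
  refine Subset.antisymm (fun lam hlam => ?_) (subset_spectrum hα)
  by_contra hcon
  have hK : lam ∈ ({0} ∪ {ν : ℂ | ∃ i : ℕ, ν = 1 / ((i : ℂ) + 1)})ᶜ :=
    fun h => hcon (exceptional_subset_spectrum hα h)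
  obtain ⟨δ, hδ, hball⟩ := Metric.isOpen_iff.1 isClosed_exceptional.isOpen_compl lam hK
  obtain ⟨M, -, h⟩ := uniform_resolvent_on_ball (p := p) hα (half_pos hδ) (s := {lam})
    (singleton_subset_iff.2 (mem_ball_self (half_pos hδ))) (fun k hk => by
      by_contra! hlt
      exact hball (by rw [mem_ball, dist_comm]; linarith) hk)
    (by rintro _ rfl h; exact hcon (Or.inl (Or.inr h)))
  exact hlam (h lam rfl).1

lemma waelbroeckSpectrum_cesaroCLM (hα : 0 < α) :
    waelbroeckSpectrum (cesaroCLM p hα) = closure (spectrum ℂ (cesaroCLM p hα)) := by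
  refine Subset.antisymm (fun lam hlam => ?_) fun lam hlam hres => ?_
  · by_contra hcon
    obtain ⟨ε, hε, hball⟩ := Metric.isOpen_iff.1 isClosed_closure.isOpen_compl lam hcon
    have hσ : ∀ ν ∈ ball lam ε, ν ∉ spectrum ℂ (cesaroCLM p hα) := fun ν hν h =>
      hball hν (subset_closure h)
    have hsub := (exceptional_subset_spectrum (p := p) hα).trans (subset_spectrum hα)
    obtain ⟨M, hM, h⟩ := uniform_resolvent_on_ball (p := p) hα (half_pos hε) (s := ball lam (ε / 2))
      Subset.rfl (fun k hk => by
        by_contra! hlt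
        exact hσ k (by rw [mem_ball, dist_comm]; linarith) (hsub hk))
      (fun ν hν hD => hσ ν (ball_subset_ball (by linarith) hν)
        (subset_spectrum hα (Or.inl (Or.inr hD))))
    refine hlam ⟨ε / 2, half_pos hε, fun ν hν => (h ν hν).1, ?_⟩
    let U : UniformSpace (BergmanPlus p α) :=
      IsTopologicalAddGroup.rightUniformSpace (BergmanPlus p α)
    have : IsUniformAddGroup (BergmanPlus p α) := isUniformAddGroup_of_addCommGroup
    -- Equicontinuity amounts to one continuous seminorm dominating the n-th norm of all resolvents
    -- on the ball; M n times the n-th norm serves.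
    refine ((withSeminorms_norms (p := p) (α := α)).uniformEquicontinuous_iff_exists_continuous_seminorm
      (fun ν : ball lam (ε / 2) => ((resolvent (cesaroCLM p hα) (ν : ℂ) :
        BergmanPlus p α →L[ℂ] BergmanPlus p α) : BergmanPlus p α →ₗ[ℂ] BergmanPlus p α))).2
      (fun n => ⟨(M n).toNNReal • norms p α n, ?_, fun ν =>
        norms_comp_le (hM n) fun g => (h ν ν.2).2 n g⟩) |>.equicontinuous
    exact (withSeminorms_norms.continuous_seminorm n).const_smul (M n).toNNReal
  -- A point of ρ* has a whole ball in the resolvent set, so it cannot be a limit of the spectrum;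
  -- equicontinuity plays no role in this inclusion.
  · obtain ⟨δ, hδ, hsub, -⟩ := hres
    obtain ⟨ν, hν, hνσ⟩ := Metric.mem_closure_iff.1 hlam δ hδ
    exact hν (hsub (by rwa [mem_ball, dist_comm]))

end CesaroBergman

theorem theorem2p3 (p α : ℝ) [Fact (1 < p)] (hα : 0 < α) :
    ∃ C : CesaroBergman.BergmanPlus p α →L[ℂ] CesaroBergman.BergmanPlus p α,
      (∀ f : CesaroBergman.BergmanPlus p α, ∀ z ∈ Metric.ball (0 : ℂ) 1,
        C f z = CesaroBergman.cesaro f z) ∧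
      {lam : ℂ | ∃ m : ℕ, 1 ≤ m ∧ (m : ℝ) < (2 + α) / p ∧ lam = 1 / (m : ℂ)} ⊆
        CesaroBergman.pointSpectrum C ∧
      CesaroBergman.pointSpectrum C ⊆
        {lam : ℂ | ∃ m : ℕ, 1 ≤ m ∧ (m : ℝ) ≤ (2 + α) / p ∧ lam = 1 / (m : ℂ)} ∧
      spectrum ℂ C =
        {0} ∪ CesaroBergman.D ((2 + α) / p) ∪ CesaroBergman.pointSpectrum C ∧
      CesaroBergman.waelbroeckSpectrum C = closure (spectrum ℂ C) := by
  refine ⟨CesaroBergman.cesaroCLM p hα, fun f z hz => CesaroBergman.cesaroCLM_apply hα f hz, ?_,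
    CesaroBergman.pointSpectrum_subset hα, CesaroBergman.spectrum_cesaroCLM hα,
    CesaroBergman.waelbroeckSpectrum_cesaroCLM hα⟩
  rintro lam ⟨m, hm1, hm, rfl⟩
  exact CesaroBergman.subset_pointSpectrum hα ⟨m, hm1, hm.le, rfl⟩
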